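/- **Setting.** Let $g:\mathbb R\to\mathbb R$ be even, subadditive and non-negative with $g(0)=0$. For an $n\times n$ real matrix $M$ write $g[M]=(g(m_{ij}))_{ij}$, $\|g[M]\|_1=\sum_{i,j}g(m_{ij})$ and $u_{g[M],i}=\sum_j g(m_{ij})$; the norm of a row vector is defined in the same way. For $H:[n]\to\{0,1\}$ let $I_H=\mathrm{diag}(H(1),\dots,H(n))$, let $\bar H=1-H$, and let $J=(1,\dots,1)$. A $(1\pm\varepsilon)$-approximation of $x\ge 0$ is a $y$ with $(1-\varepsilon)x\le y\le(1+\varepsilon)x$; an $r$-approximation is a $y$ with $x/r\le y\le rx$. Suppose that for the input matrix $A$ there are two randomized black boxes. For all $\delta,\varepsilon'\in(0,1)$ and every $H$, $BA1(A,H)$ returns a $(1\pm\varepsilon')$-approximation of $\|g[JI_HA]\|_1$ except with probability $\delta$, in $SPACE1(n,\delta,\varepsilon')$ bits. For every $\delta\in(0,1)$ and every $H$, $BA2(A,H)$ returns an $r(n)$-approximation of $\|g[I_HA]\|_1$, $r(n)\ge 1$, except with probability $\delta$, in $SPACE2(n,\delta)$ bits. All calls use independent randomness. **Find-Key-Row$(A,H)$**,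 with accuracy parameter $\eta$. For $\ell=1,\dots,N$, $N=\Theta(\log n)$: draw a uniform pairwise independent $H_\ell:[n]\to\{0,1\}$; let $y_1=BA2(A,HH_\ell)$ and $y_0=BA2(A,H\bar H_\ell)$ (failure probability $\delta_2$); with $T=2r(n)^2/(c_T\eta)$ put $b_\ell=0$ if $y_0\ge Ty_1$, otherwise $b_\ell=1$ if $y_1\ge Ty_0$, otherwise $b_\ell=2$. If $|\{\ell:b_\ell=2\}|\ge\frac23N$, return $(-1,0)$. Otherwise, if some row $i$ satisfies $|\{\ell:H_\ell(i)=b_\ell\}|\ge\frac34N$, return $(i,BA1(A,H))$ for the first such $i$, with $BA1$ run with $\varepsilon'=\eta/2$ and failure probability $\delta_1$. Otherwise return $(-1,0)$. **Find-Heavy-Rows** on $I_PA$, where $P:[n]\to\{0,1\}$, with parameter $\alpha$. Draw a uniform pairwise independent $H:[n]\to[\tau]$, where $\tau=\Theta(\rho\log n/\alpha^2)$ is a power of two and $\rho=r(n)^4/\eta$. For $k\in[\tau]$ let $C_k=$ Find-Key-Row$(A,P\cdot\mathbf 1[H(\cdot)=k])$. Return $\{C_k:C_k\ne(-1,0)\}$.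 **Recursive Sum.** Let $\phi=\Theta(\log n)$ and draw independent, uniform pairwise independent $h^1,\dots,h^\phi:[n]\to\{0,1\}$. For $0\le j<\phi$ let $Q_j$ be the output of Find-Heavy-Rows on $I_{h^1\cdots h^j}A$ with $\alpha=\eta^2/\phi^3$. Let $V_\phi$ be the vector of the row weights $u_{g[I_{h^1\cdots h^\phi}A],i}$. If $V_\phi$ has more than $10^{10}$ non-zero entries, output $0$. Otherwise let $Y_\phi=|V_\phi|$ be the exact sum of its entries, let $Y_j=2Y_{j+1}+\sum_{(i,w)\in Q_j}(1-2h^{j+1}_i)\,w$ for $j=\phi-1,\dots,0$, and output $Y_0$. **Memory** is counted as the total number of random bits specifying the hash functions plus the memory of all black-box instances, all kept simultaneously; the exact evaluation of $V_\phi$ in the last phase and the post-processing of the black-box outputs are not charged. **Theorem.** There are absolute constants for the choice of $\phi$, $\tau$, $T$, an absolute constant $\delta_2\in(0,1)$, and absolute constants $c_\eta\in(0,1]$ and $c_1>0$, such that for every $c\in\mathbb N$ and every $K\in\mathbb R$ there are constants $c_N,C>0$ for which the following holds. Let $n\ge2$, $0<\varepsilon\le1$, $1\le r(n)\le n^c$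 and $1/\varepsilon\le n^c$, and let $g$, $A$ and the black boxes be as above. Run Recursive Sum with Find-Heavy-Rows as its heavy-hitter subroutine, with $\eta=c_\eta\varepsilon$ (so $\alpha=\Theta(\varepsilon^2/\log^3n)$), $N=\lceil c_N\log n\rceil$ and $\delta_1=1/(c_1\tau\log n)$, and with arbitrary uniform pairwise independent hash families whose seeds have at most $K\log n$ bits (for values in $\{0,1\}$) and at most $K(\log n+\log\tau)$ bits (for values in $[\tau]$). Then the output is a $(1\pm\varepsilon)$-approximation of $\|g[A]\|_1$ except with probability at most $0.3$, and in every run the memory is at most $$C\left(\frac{r(n)^4\log^{10}n}{\varepsilon^5}+\frac{r(n)^4\log^{8}n}{\varepsilon^5}\,SPACE1\!\left(n,\delta_1,\tfrac{\eta}{2}\right)+\frac{r(n)^4\log^{9}n}{\varepsilon^5}\,SPACE2(n,\delta_2)\right).$$ -/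

import Mathlib

/-! ### Matrices, Hadamard functions and row sampling -/

/-- `g` is an even, subadditive, non-negative function vanishing at the origin. -/
structure IsHadamardFunction (g : ℝ → ℝ) : Prop where
  even : ∀ x, g (-x) = g x
  subadditive : ∀ x y, g (x + y) ≤ g x + g y
  nonneg : ∀ x, 0 ≤ g x
  zero : g 0 = 0

/-- `‖g[M]‖₁ = ∑ᵢ ∑ⱼ g (mᵢⱼ)`. -/
noncomputable def hadamardNorm (g : ℝ → ℝ) {m n : ℕ} (M : Matrix (Fin m) (Fin n) ℝ) : ℝ :=
  ∑ i, ∑ j, g (M i j)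

/-- The weight of row `i` of `g[M]`. -/
noncomputable def rowWeight (g : ℝ → ℝ) {m n : ℕ} (M : Matrix (Fin m) (Fin n) ℝ) (i : Fin m) : ℝ :=
  ∑ j, g (M i j)

/-- The sampling identity matrix `I_H` of a zero-one hash function `H`. -/
def samplingIdentity {n : ℕ} (H : Fin n → Bool) : Matrix (Fin n) (Fin n) ℝ :=
  Matrix.diagonal fun i => if H i then 1 else 0

/-- The row aggregation vector `J = (1, …, 1)`. -/
def rowAggregation (n : ℕ) : Matrix (Fin 1) (Fin n) ℝ :=
  Matrix.of fun _ _ => 1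

/-- Entrywise product of two zero-one hash functions. -/
def hadHash {n : ℕ} (H H' : Fin n → Bool) : Fin n → Bool := fun i => H i && H' i

/-- The complement of a zero-one hash function. -/
def complHash {n : ℕ} (H : Fin n → Bool) : Fin n → Bool := fun i => !H i

/-- `y` is a `(1 ± ε)`-approximation of `x`. -/
def IsRelApprox (ε y x : ℝ) : Prop := (1 - ε) * x ≤ y ∧ y ≤ (1 + ε) * x

/-- `y` is an `r`-approximation of `x`. -/
def IsFactorApprox (r y x : ℝ) : Prop := x / r ≤ y ∧ y ≤ r * x

/-! ### Randomized algorithms with a memory count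

An algorithm is a randomized computation together with a counter of the bits of memory allocated
so far. Memory is never released: all parts of the algorithm run in parallel over the same input, so
their memory adds up. What is charged is every random bit that specifies a hash function and the
memory of every black-box instance. -/

/-- Randomized computations with a counter of allocated bits. -/
abbrev Alg (β : Type) : Type := StateT ℕ PMF β

/-- Allocate `b` bits. -/
noncomputable def Alg.alloc (b : ℕ) : Alg Unit := modify fun s => s + b

/-- Use fresh randomness, without allocating memory. -/
noncomputable def Alg.sample {β : Type} (p : PMF β) : Alg β := StateT.lift p

/-- The joint law of the output and of the number of bits allocated. -/
noncomputable def Alg.law {β : Type} (a : Alg β) : PMF (β × ℕ) := StateT.run a 0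

/-- A black-box algorithm: a randomized procedure with input a matrix and a zero-one hash function,
and the number of bits of memory that it uses. -/
structure BlackBox (n : ℕ) where
  run : Matrix (Fin n) (Fin n) ℝ → (Fin n → Bool) → PMF ℝ
  space : ℕ

/-- One run of a black box, with fresh randomness and its own memory. -/
noncomputable def BlackBox.call {n : ℕ} (B : BlackBox n) (A : Matrix (Fin n) (Fin n) ℝ)
    (H : Fin n → Bool) : Alg ℝ := do
  Alg.alloc B.space
  Alg.sample (B.run A H)

/-- Black-box guarantee 1: on the matrix `A`, for every hash function `H`, the output is a
`(1 ± ε')`-approximation of `‖g[J I_H A]‖₁`, except with probability `δ`. -/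
def ApproximatesAggregate (g : ℝ → ℝ) {n : ℕ} (A : Matrix (Fin n) (Fin n) ℝ) (δ ε' : ℝ)
    (B : BlackBox n) : Prop :=
  ∀ H : Fin n → Bool,
    (B.run A H).toOuterMeasure
      {y | ¬ IsRelApprox ε' y (hadamardNorm g (rowAggregation n * (samplingIdentity H * A)))}
        ≤ ENNReal.ofReal δ

/-- Black-box guarantee 2: on the matrix `A`, for every hash function `H`, the output is an
`r`-approximation of `‖g[I_H A]‖₁`, except with probability `δ`. -/
def ApproximatesNorm (g : ℝ → ℝ) {n : ℕ} (A : Matrix (Fin n) (Fin n) ℝ) (δ r : ℝ)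
    (B : BlackBox n) : Prop :=
  ∀ H : Fin n → Bool,
    (B.run A H).toOuterMeasure
      {y | ¬ IsFactorApprox r y (hadamardNorm g (samplingIdentity H * A))}
        ≤ ENNReal.ofReal δ

/-- A family of hash functions `[n] → β` indexed by strings of `bits` random bits. -/
structure HashFamily (n : ℕ) (β : Type) where
  bits : ℕ
  eval : (Fin bits → Bool) → Fin n → β

/-- For a uniformly random seed, every hash value is uniform on `β`, and the hash values of two
different points are independent. -/
def HashFamily.PairwiseIndependent {n : ℕ} {β : Type} (F : HashFamily n β) : Prop :=
  (∀ i a, Nat.card {s // F.eval s i = a} * Nat.card β = 2 ^ F.bits) ∧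
  ∀ i j, i ≠ j → ∀ a b,
    Nat.card {s // F.eval s i = a ∧ F.eval s j = b} * Nat.card β ^ 2 = 2 ^ F.bits

/-- Draw a hash function of the family; its seed is kept in memory. -/
noncomputable def HashFamily.draw {n : ℕ} {β : Type} (F : HashFamily n β) : Alg (Fin n → β) := do
  Alg.alloc F.bits
  let s ← Alg.sample (PMF.uniformOfFintype (Fin F.bits → Bool))
  pure (F.eval s)

/-! ### The algorithms -/

open Classical in
/-- One iteration of Find-Key-Row: the hash function `H_ℓ` and the value `b_ℓ`, where `some false`,
`some true` and `none` stand for `0`, `1` and `2`. -/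
noncomputable def keyRowVote {n : ℕ} (F : HashFamily n Bool) (BA2 : BlackBox n) (threshold : ℝ)
    (A : Matrix (Fin n) (Fin n) ℝ) (H : Fin n → Bool) : Alg ((Fin n → Bool) × Option Bool) := do
  let Hl ← F.draw
  let y1 ← BA2.call A (hadHash H Hl)
  let y0 ← BA2.call A (hadHash H (complHash Hl))
  pure (Hl,
    if threshold * y1 ≤ y0 then some false
    else if threshold * y0 ≤ y1 then some true
    else none)

/-- Find-Key-Row with `N` iterations; `none` stands for the answer `(-1, 0)`. -/
noncomputable def findKeyRow {n : ℕ} (F : HashFamily n Bool) (BA1 BA2 : BlackBox n)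
    (threshold : ℝ) (N : ℕ) (A : Matrix (Fin n) (Fin n) ℝ) (H : Fin n → Bool) :
    Alg (Option (Fin n × ℝ)) := do
  let votes ← (List.range N).mapM fun _ => keyRowVote F BA2 threshold A H
  if 2 * N ≤ 3 * votes.countP (fun v => v.2 == none) then
    pure none
  else
    match (List.finRange n).find?
        (fun i => decide (3 * N ≤ 4 * votes.countP (fun v => v.2 == some (v.1 i)))) with
    | none => pure none
    | some i => do
      let a ← BA1.call A H
      pure (some (i, a))

open Classical in
/-- Find-Heavy-Rows on the matrix `I_P A`, with `τ` buckets. -/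
noncomputable def findHeavyRows {n τ : ℕ} (F : HashFamily n Bool) (G : HashFamily n (Fin τ))
    (BA1 BA2 : BlackBox n) (threshold : ℝ) (N : ℕ) (A : Matrix (Fin n) (Fin n) ℝ)
    (P : Fin n → Bool) : Alg (Finset (Fin n × ℝ)) := do
  let H ← G.draw
  let C ← (List.finRange τ).mapM fun k =>
    findKeyRow F BA1 BA2 threshold N A (hadHash P fun i => decide (H i = k))
  pure C.reduceOption.toFinset

/-- The product `H₁ ⋯ H_j` of the first `j` zero-one vectors of a list. -/
def prefixHash {n : ℕ} (hs : List (Fin n → Bool)) (j : ℕ) : Fin n → Bool :=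
  fun i => (hs.take j).all fun h => h i

/-- The recursion `Y_j = 2 Y_{j+1} + ∑_{(i, w) ∈ Q_j} (1 - 2 h_i^{j+1}) w` started at
`Y_φ = Y`; the value is `Y₀`. The lists are `[H₁, …, H_φ]` and `[Q₀, …, Q_{φ-1}]`. -/
noncomputable def combineLevels {n : ℕ} (hs : List (Fin n → Bool))
    (Qs : List (Finset (Fin n × ℝ))) (Y : ℝ) : ℝ :=
  (hs.zip Qs).foldr
    (fun hQ Y' => 2 * Y' + ∑ p ∈ hQ.2, (1 - 2 * (if hQ.1 p.1 then (1 : ℝ) else 0)) * p.2) Y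

open Classical in
/-- Recursive Sum with `φ` levels on the vector of row weights of `g[A]`, with Find-Heavy-Rows as
the heavy-hitter subroutine. -/
noncomputable def recursiveSum (g : ℝ → ℝ) {n τ : ℕ} (F : HashFamily n Bool)
    (G : HashFamily n (Fin τ)) (BA1 BA2 : BlackBox n) (threshold : ℝ) (N φ : ℕ)
    (A : Matrix (Fin n) (Fin n) ℝ) : Alg ℝ := do
  let hs ← (List.range φ).mapM fun _ => F.draw
  let Qs ← (List.range φ).mapM fun j =>
    findHeavyRows F G BA1 BA2 threshold N A (prefixHash hs j)
  let V : Fin n → ℝ := rowWeight g (samplingIdentity (prefixHash hs φ) * A)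
  if 10 ^ 10 < (Finset.univ.filter fun i => V i ≠ 0).card then
    pure 0
  else
    pure (combineLevels hs Qs (∑ i, V i))

/-! ### The parameters -/

/-- The number `φ = O(log n)` of levels; also used for the number `N = O(log n)` of iterations. -/
noncomputable def logSize (c : ℝ) (n : ℕ) : ℕ := ⌈c * Real.log n⌉₊

/-- The heaviness parameter `α = η² / φ³`. -/
noncomputable def heavyParam (η : ℝ) (φ : ℕ) : ℝ := η ^ 2 / (φ : ℝ) ^ 3

/-- The threshold function `ρ = r⁴ / η`. -/
noncomputable def rhoParam (r η : ℝ) : ℝ := r ^ 4 / η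

/-- The number of buckets: the least power of two that is at least `c ρ log n / α²`. -/
noncomputable def bucketCount (c ρ α : ℝ) (n : ℕ) : ℕ :=
  2 ^ Nat.clog 2 ⌈c * ρ * Real.log n / α ^ 2⌉₊

/-! Output and memory are analysed separately. `HasOutput` forgets the bit counter and reduces every
algorithm to an explicit `PMF`. `UsesAtMost` bounds the counter on the whole support, so the memory
bound holds in every run and is a product of loop lengths.

Find-Key-Row rests on a random split of the sampled rows into two halves. If one row outweighs all
the others by a factor of order r⁴/η, its half always wins the comparison of the two estimates
(`keyRow_imp_agree`). If the remaining rows weigh more than η/4 times row i, the half without row i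
receives at most a tenth of that remaining weight with probability at most 5/9, and otherwise the
vote does not favour row i (`prob_agree_le`). Chernoff bounds over N votes separate the two cases.
For a row that passes, subadditivity puts the aggregate within the weight of the other rows
(`IsHadamardFunction.abs_aggregate_sub_le`), so the reported weight has relative error η
(`keyRowLaw_prob_le`). Hashing into τ buckets isolates every α-heavy row (`prob_not_isolates_le`),
which gives `heavyRowsLaw_prob_le`.

For Recursive Sum, the sampled weight at one level is twice that at the next plus a sum with random
signs, so the output error is a sum over levels of signed sums of the reporting errors, scaled by
powers of two. The reported sets of a level can be drawn before the next hash function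
(`bind_mapM_eq_interleavedLaw`); conditionally on them the signs are centred and uncorrelated, and
squared errors add up. A direct variance bound fails, since the scaled square of a row's weight
grows geometrically in expectation. Instead, a potential per row (`levelPotential`) pays for the
squared error while the scaled weights are moderate, and is at least 1 in total once a row or a
level becomes too heavy. Together with the squared accumulated error it is a supermartingale
(`mean_potential_le`), whose initial value, at most 1/10, bounds the failure probability apart from
incorrect reported sets (`interleavedLaw_prob_le`). Every average over a hash family involves at
most two hash values, so pairwise independence suffices. -/

open scoped ENNReal

/-! ### Expectations over discrete distributions -/

namespace PMF

variable {α β : Type}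

/-- The expectation of a non-negative function. -/
noncomputable def expect (p : PMF α) (f : α → ℝ≥0∞) : ℝ≥0∞ := ∑' a, p a * f a

theorem expect_pure (a : α) (f : α → ℝ≥0∞) : (PMF.pure a).expect f = f a := by
  classical
  unfold expect
  rw [tsum_eq_single a]
  · simp
  · intro b hb
    simp [PMF.pure_apply, hb]

theorem expect_bind (p : PMF α) (q : α → PMF β) (f : β → ℝ≥0∞) :
    (p.bind q).expect f = p.expect fun a => (q a).expect f := by
  unfold expect
  simp only [PMF.bind_apply, ← ENNReal.tsum_mul_right, ← ENNReal.tsum_mul_left]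
  rw [ENNReal.tsum_comm]
  simp only [mul_assoc]

theorem expect_mono (p : PMF α) {f g : α → ℝ≥0∞} (h : ∀ a, f a ≤ g a) :
    p.expect f ≤ p.expect g :=
  ENNReal.tsum_le_tsum fun a => mul_le_mul_right (h a) _

theorem expect_add (p : PMF α) (f g : α → ℝ≥0∞) :
    (p.expect fun a => f a + g a) = p.expect f + p.expect g := by
  unfold expect
  simp only [mul_add, ENNReal.tsum_add]

theorem expect_const (p : PMF α) (c : ℝ≥0∞) : (p.expect fun _ => c) = c := by
  unfold expect
  rw [ENNReal.tsum_mul_right, p.tsum_coe, one_mul]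

theorem expect_mul_const (p : PMF α) (f : α → ℝ≥0∞) (c : ℝ≥0∞) :
    (p.expect fun a => f a * c) = p.expect f * c := by
  unfold expect
  simp only [← mul_assoc, ENNReal.tsum_mul_right]

theorem expect_const_mul (p : PMF α) (f : α → ℝ≥0∞) (c : ℝ≥0∞) :
    (p.expect fun a => c * f a) = c * p.expect f := by
  simp only [mul_comm c, expect_mul_const]

/-- The probability of an event. -/
noncomputable def prob (p : PMF α) (S : α → Prop) : ℝ≥0∞ := p.toOuterMeasure {a | S a}

theorem prob_eq_expect (p : PMF α) (S : α → Prop) [DecidablePred S] :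
    p.prob S = p.expect fun a => if S a then 1 else 0 := by
  unfold prob expect
  rw [PMF.toOuterMeasure_apply]
  refine tsum_congr fun a => ?_
  by_cases h : S a <;> simp [Set.indicator, h]

theorem prob_bind (p : PMF α) (q : α → PMF β) (S : β → Prop) :
    (p.bind q).prob S = p.expect fun a => (q a).prob S := by
  classical
  simp only [prob_eq_expect, expect_bind]

theorem prob_pure (a : α) (S : α → Prop) [Decidable (S a)] :
    (PMF.pure a).prob S = if S a then 1 else 0 := by
  classical
  rw [prob_eq_expect, expect_pure]
  congr

theorem prob_le_one (p : PMF α) (S : α → Prop) : p.prob S ≤ 1 := by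
  classical
  rw [prob_eq_expect]
  refine (p.expect_mono (g := fun _ => 1) fun a => ?_).trans (p.expect_const 1).le
  by_cases h : S a <;> simp [h]

theorem prob_mono (p : PMF α) {S T : α → Prop} (h : ∀ a, S a → T a) : p.prob S ≤ p.prob T :=
  MeasureTheory.measure_mono h

theorem prob_or (p : PMF α) (S T : α → Prop) : (p.prob fun a => S a ∨ T a) ≤ p.prob S + p.prob T :=
  MeasureTheory.measure_union_le {a | S a} {a | T a}

theorem prob_exists {ι : Type} [Fintype ι] (p : PMF α) (S : ι → α → Prop) :
    (p.prob fun a => ∃ i, S i a) ≤ ∑ i, p.prob (S i) := by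
  unfold prob
  rw [Set.ofPred_exists]
  exact MeasureTheory.measure_iUnion_fintype_le p.toOuterMeasure _

theorem prob_map (p : PMF α) (f : α → β) (S : β → Prop) :
    (p.map f).prob S = p.prob fun a => S (f a) := by
  unfold prob
  rw [PMF.toOuterMeasure_map_apply]
  rfl

/-- Markov's inequality. -/
theorem prob_mul_le_expect (p : PMF α) (S : α → Prop) (f : α → ℝ≥0∞) (c : ℝ≥0∞)
    (h : ∀ a, S a → c ≤ f a) : p.prob S * c ≤ p.expect f := by
  classical
  rw [prob_eq_expect, ← expect_mul_const]
  refine p.expect_mono fun a => ?_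
  split_ifs with hS
  · simpa using h a hS
  · simp

/-- The union bound in sequential form: either the first stage is bad, or the second fails given a
good first stage. It replaces conditioning throughout. -/
theorem prob_bind_le_add (p : PMF α) (q : α → PMF β) (B : α → Prop) (S : β → Prop) (c : ℝ≥0∞)
    (h : ∀ a, ¬ B a → (q a).prob S ≤ c) : (p.bind q).prob S ≤ p.prob B + c := by
  classical
  rw [prob_bind, prob_eq_expect]
  nth_rw 1 [← p.expect_const c]
  rw [← expect_add]
  refine p.expect_mono fun a => ?_
  split_ifs with hB
  · exact (prob_le_one _ _).trans le_self_add
  · simpa using h a hB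

theorem expect_uniformOfFintype {σ : Type} [Fintype σ] [Nonempty σ] (f : σ → ℝ)
    (hf : ∀ s, 0 ≤ f s) :
    (PMF.uniformOfFintype σ).expect (fun s => ENNReal.ofReal (f s))
      = ENNReal.ofReal ((∑ s, f s) / Fintype.card σ) := by
  unfold expect
  rw [tsum_fintype]
  simp only [PMF.uniformOfFintype_apply]
  have hc : (0 : ℝ) < Fintype.card σ := by exact_mod_cast Fintype.card_pos
  rw [← Finset.mul_sum, ← ENNReal.ofReal_sum_of_nonneg fun s _ => hf s,
    ENNReal.ofReal_div_of_pos hc, ENNReal.ofReal_natCast, mul_comm, div_eq_mul_inv]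

end PMF

/-! ### Output law and memory of an algorithm -/

namespace Alg

variable {α β : Type}

/-- The output of `a` has law `p`, whatever has been allocated before. -/
def HasOutput (a : Alg β) (p : PMF β) : Prop := ∀ s, (StateT.run a s).map Prod.fst = p

theorem HasOutput.pure (b : β) : HasOutput (Pure.pure b : Alg β) (PMF.pure b) := fun s => by
  change PMF.map Prod.fst (PMF.pure (b, s)) = _
  rw [PMF.pure_map]

/-- `HasOutput` quantifies over the initial counter precisely so that it composes: the continuation
starts from whatever count the first part left. -/
theorem HasOutput.bind {a : Alg α} {p : PMF α} {f : α → Alg β} {q : α → PMF β}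
    (ha : HasOutput a p) (hf : ∀ x, HasOutput (f x) (q x)) :
    HasOutput (a >>= f) (p.bind q) := fun s => by
  rw [StateT.run_bind]
  change PMF.map Prod.fst (PMF.bind (StateT.run a s) fun x => StateT.run (f x.1) x.2) = _
  rw [PMF.map_bind, ← ha s, PMF.bind_map]
  congr 1
  funext x
  exact hf x.1 x.2

theorem HasOutput.alloc (b : ℕ) : HasOutput (Alg.alloc b) (PMF.pure ()) := fun s => by
  change PMF.map Prod.fst (PMF.pure ((), s + b)) = _
  rw [PMF.pure_map]

theorem HasOutput.sample (p : PMF β) : HasOutput (Alg.sample p) p := fun s => by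
  change PMF.map Prod.fst (PMF.bind p fun a => PMF.pure (a, s)) = _
  rw [PMF.map_bind]
  simp [PMF.pure_map, PMF.bind_pure]

theorem HasOutput.alloc_bind {b : ℕ} {f : Unit → Alg β} {q : PMF β} (hf : HasOutput (f ()) q) :
    HasOutput (Alg.alloc b >>= f) q := by
  have := (HasOutput.alloc b).bind (q := fun _ => q) fun _ => hf
  rwa [PMF.pure_bind] at this

theorem HasOutput.mapM {f : α → Alg β} {q : α → PMF β} (hf : ∀ x, HasOutput (f x) (q x))
    (l : List α) : HasOutput (l.mapM f) (l.mapM q) := by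
  induction l with
  | nil => exact HasOutput.pure []
  | cons x l ih =>
    rw [List.mapM_cons, List.mapM_cons]
    exact (hf x).bind fun y => ih.bind fun ys => HasOutput.pure _

theorem HasOutput.law {a : Alg β} {p : PMF β} (h : HasOutput a p) (S : β → Prop) :
    a.law.toOuterMeasure {x | S x.1} = p.prob S := by
  rw [← h 0, PMF.prob_map]
  rfl

/-- `a` allocates at most `b` bits. -/
def UsesAtMost (a : Alg β) (b : ℕ) : Prop := ∀ s, ∀ x ∈ (StateT.run a s).support, x.2 ≤ s + b

theorem UsesAtMost.mono {a : Alg β} {b c : ℕ} (h : UsesAtMost a b) (hbc : b ≤ c) :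
    UsesAtMost a c := fun s x hx => (h s x hx).trans (by omega)

theorem UsesAtMost.pure (b : β) : UsesAtMost (Pure.pure b : Alg β) 0 := fun s x hx => by
  change x ∈ (PMF.pure (b, s)).support at hx
  simp at hx
  simp [hx]

theorem UsesAtMost.bind {a : Alg α} {f : α → Alg β} {b c : ℕ} (ha : UsesAtMost a b)
    (hf : ∀ x, UsesAtMost (f x) c) : UsesAtMost (a >>= f) (b + c) := fun s x hx => by
  rw [StateT.run_bind] at hx
  change x ∈ (PMF.bind (StateT.run a s) fun x => StateT.run (f x.1) x.2).support at hx
  rw [PMF.mem_support_bind_iff] at hx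
  obtain ⟨y, hy, hx⟩ := hx
  have := ha s y hy
  have := hf _ _ x hx
  omega

theorem UsesAtMost.alloc (b : ℕ) : UsesAtMost (Alg.alloc b) b := fun s x hx => by
  change x ∈ (PMF.pure ((), s + b)).support at hx
  simp at hx
  simp [hx]

theorem UsesAtMost.sample (p : PMF β) : UsesAtMost (Alg.sample p) 0 := fun s x hx => by
  change x ∈ (PMF.bind p fun a => PMF.pure (a, s)).support at hx
  simp at hx
  obtain ⟨y, -, rfl⟩ := hx
  simp

theorem UsesAtMost.mapM {f : α → Alg β} {b : ℕ} (hf : ∀ x, UsesAtMost (f x) b)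
    (l : List α) : UsesAtMost (l.mapM f) (l.length * b) := by
  induction l with
  | nil => simpa using UsesAtMost.pure ([] : List β)
  | cons x l ih =>
    rw [List.mapM_cons]
    refine ((hf x).bind fun y => ih.bind fun ys => UsesAtMost.pure _).mono ?_
    simp [add_mul]
    omega

end Alg

/-! ### Averages over a hash family -/

namespace HashFamily

variable {n : ℕ} {β : Type}

/-- The law of a random member of the family. -/
noncomputable def law (F : HashFamily n β) : PMF (Fin n → β) :=
  (PMF.uniformOfFintype (Fin F.bits → Bool)).bind fun s => PMF.pure (F.eval s)

/-- The average of a real function over the family. -/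
noncomputable def mean (F : HashFamily n β) (f : (Fin n → β) → ℝ) : ℝ :=
  (∑ s, f (F.eval s)) / 2 ^ F.bits

theorem law_expect (F : HashFamily n β) (f : (Fin n → β) → ℝ) (hf : ∀ h, 0 ≤ f h) :
    (F.law.expect fun h => ENNReal.ofReal (f h)) = ENNReal.ofReal (F.mean f) := by
  unfold law mean
  rw [PMF.expect_bind]
  simp only [PMF.expect_pure]
  rw [PMF.expect_uniformOfFintype (fun s => f (F.eval s)) fun s => hf _]
  simp

theorem mean_const (F : HashFamily n β) (c : ℝ) : (F.mean fun _ => c) = c := by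
  simp [mean]

theorem mean_add (F : HashFamily n β) (f f' : (Fin n → β) → ℝ) :
    (F.mean fun h => f h + f' h) = F.mean f + F.mean f' := by
  simp [mean, Finset.sum_add_distrib, add_div]

theorem mean_sub (F : HashFamily n β) (f f' : (Fin n → β) → ℝ) :
    (F.mean fun h => f h - f' h) = F.mean f - F.mean f' := by
  simp [mean, Finset.sum_sub_distrib, sub_div]

theorem mean_const_mul (F : HashFamily n β) (c : ℝ) (f : (Fin n → β) → ℝ) :
    (F.mean fun h => c * f h) = c * F.mean f := by
  simp [mean, ← Finset.mul_sum, mul_div_assoc]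

theorem mean_sum {ι : Type} (F : HashFamily n β) (t : Finset ι) (f : ι → (Fin n → β) → ℝ) :
    (F.mean fun h => ∑ i ∈ t, f i h) = ∑ i ∈ t, F.mean (f i) := by
  simp only [mean]
  rw [Finset.sum_comm, Finset.sum_div]

theorem mean_indicator (F : HashFamily n β) (P : (Fin n → β) → Prop) [DecidablePred P] :
    (F.mean fun h => if P h then 1 else 0) = Nat.card {s // P (F.eval s)} / 2 ^ F.bits := by
  unfold mean
  rw [Nat.card_eq_fintype_card, Fintype.card_subtype]
  simp

theorem mean_apply [Fintype β] {F : HashFamily n β} (hF : F.PairwiseIndependent)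
    (i : Fin n) (f : β → ℝ) :
    (F.mean fun h => f (h i)) = (∑ a, f a) / Fintype.card β := by
  classical
  have h1 : ∀ a, (F.mean fun h => if h i = a then 1 else 0) = 1 / Fintype.card β := fun a => by
    have h := hF.1 i a
    rw [Nat.card_eq_fintype_card (α := β)] at h
    have h' : (Nat.card {s // F.eval s i = a} : ℝ) * Fintype.card β = 2 ^ F.bits := by
      exact_mod_cast h
    have hβ : (Fintype.card β : ℝ) ≠ 0 := fun h0 => by
      rw [h0, mul_zero] at h'
      exact absurd h'.symm (by positivity)
    rw [mean_indicator, div_eq_div_iff (by positivity) hβ, h', one_mul]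
  have h2 : (fun h : Fin n → β => f (h i)) = fun h => ∑ a, f a * (if h i = a then 1 else 0) := by
    funext h
    simp
  rw [h2, mean_sum, Finset.sum_div]
  refine Finset.sum_congr rfl fun a _ => ?_
  rw [mean_const_mul, h1, mul_one_div]

theorem mean_apply_apply [Fintype β] {F : HashFamily n β} (hF : F.PairwiseIndependent)
    {i j : Fin n} (hij : i ≠ j) (f : β → β → ℝ) :
    (F.mean fun h => f (h i) (h j)) = (∑ a, ∑ b, f a b) / (Fintype.card β : ℝ) ^ 2 := by
  classical
  have h1 : ∀ a b, (F.mean fun h => if h i = a ∧ h j = b then 1 else 0)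
      = 1 / (Fintype.card β : ℝ) ^ 2 := fun a b => by
    have h := hF.2 i j hij a b
    rw [Nat.card_eq_fintype_card (α := β)] at h
    have h' : (Nat.card {s // F.eval s i = a ∧ F.eval s j = b} : ℝ) * (Fintype.card β : ℝ) ^ 2
        = 2 ^ F.bits := by
      exact_mod_cast h
    have hβ : (Fintype.card β : ℝ) ^ 2 ≠ 0 := fun h0 => by
      rw [h0, mul_zero] at h'
      exact absurd h'.symm (by positivity)
    rw [mean_indicator, div_eq_div_iff (by positivity) hβ, h', one_mul]
  have h2 : (fun h : Fin n → β => f (h i) (h j))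
      = fun h => ∑ a, ∑ b, f a b * (if h i = a ∧ h j = b then 1 else 0) := by
    funext h
    simp [ite_and]
  rw [h2, mean_sum, Finset.sum_div]
  refine Finset.sum_congr rfl fun a _ => ?_
  rw [mean_sum, Finset.sum_div]
  refine Finset.sum_congr rfl fun b _ => ?_
  rw [mean_const_mul, h1, mul_one_div]

theorem mean_collision {τ : ℕ} {G : HashFamily n (Fin τ)} (hG : G.PairwiseIndependent)
    {i j : Fin n} (hij : i ≠ j) :
    (G.mean fun h => if h j = h i then 1 else 0) = 1 / (τ : ℝ) := by
  rw [mean_apply_apply hG hij.symm (fun a b => if a = b then 1 else 0)]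
  rcases Nat.eq_zero_or_pos τ with rfl | hτ
  · simp
  · have : (τ : ℝ) ≠ 0 := by positivity
    simp
    field_simp

/-- A signed sum over a pairwise independent family of signs has the variance of independent
signs. -/
theorem mean_sq_signedSum {F : HashFamily n Bool} (hF : F.PairwiseIndependent) (M : ℝ)
    (a : Fin n → ℝ) :
    (F.mean fun h => (M + ∑ i, (1 - 2 * (if h i then (1 : ℝ) else 0)) * a i) ^ 2)
      = M ^ 2 + ∑ i, a i ^ 2 := by
  have h1 : ∀ i, (F.mean fun h => 1 - 2 * (if h i then (1 : ℝ) else 0)) = 0 := fun i => by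
    rw [mean_apply hF i fun b => 1 - 2 * (if b then (1 : ℝ) else 0)]
    norm_num
  have h2 : ∀ i j, (F.mean fun h => (1 - 2 * (if h i then (1 : ℝ) else 0))
      * (1 - 2 * (if h j then (1 : ℝ) else 0))) = if i = j then 1 else 0 := fun i j => by
    split_ifs with hij
    · subst hij
      rw [mean_apply hF i fun b => (1 - 2 * (if b then (1 : ℝ) else 0))
        * (1 - 2 * (if b then (1 : ℝ) else 0))]
      norm_num
    · rw [mean_apply_apply hF hij fun b b' => (1 - 2 * (if b then (1 : ℝ) else 0))
        * (1 - 2 * (if b' then (1 : ℝ) else 0))]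
      norm_num
  have h3 : (fun h : Fin n → Bool =>
        (M + ∑ i, (1 - 2 * (if h i then (1 : ℝ) else 0)) * a i) ^ 2)
      = fun h => M ^ 2 + (∑ i, (2 * M * a i) * (1 - 2 * (if h i then (1 : ℝ) else 0))
        + ∑ i, ∑ j, (a i * a j) * ((1 - 2 * (if h i then (1 : ℝ) else 0))
          * (1 - 2 * (if h j then (1 : ℝ) else 0)))) := by
    funext h
    rw [add_sq, add_assoc]
    congr 1
    congr 1
    · rw [Finset.mul_sum]
      exact Finset.sum_congr rfl fun i _ => by ring
    · rw [sq, Finset.sum_mul_sum]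
      exact Finset.sum_congr rfl fun i _ => Finset.sum_congr rfl fun j _ => by ring
  rw [h3, mean_add, mean_const, mean_add, mean_sum, mean_sum]
  simp only [mean_sum, mean_const_mul, h1, h2]
  simp [sq]

end HashFamily

/-! ### Laws of the outputs of the algorithms -/

open Classical in
/-- The vote of one iteration of Find-Key-Row, as a function of the two norm estimates. -/
noncomputable def voteValue (T y1 y0 : ℝ) : Option Bool :=
  if T * y1 ≤ y0 then some false else if T * y0 ≤ y1 then some true else none

/-- The law of one iteration of Find-Key-Row. -/
noncomputable def voteLaw {n : ℕ} (F : HashFamily n Bool) (b2 : (Fin n → Bool) → PMF ℝ) (T : ℝ)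
    (H : Fin n → Bool) : PMF ((Fin n → Bool) × Option Bool) :=
  F.law.bind fun Hl => (b2 (hadHash H Hl)).bind fun y1 =>
    (b2 (hadHash H (complHash Hl))).bind fun y0 => PMF.pure (Hl, voteValue T y1 y0)

/-- The number of votes that agree with row `i`. -/
def agreeCount {n : ℕ} (votes : List ((Fin n → Bool) × Option Bool)) (i : Fin n) : ℕ :=
  votes.countP fun v => v.2 == some (v.1 i)

/-- The row singled out by the votes, if any. -/
def keyRowIndex {n : ℕ} (N : ℕ) (votes : List ((Fin n → Bool) × Option Bool)) : Option (Fin n) :=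
  if 2 * N ≤ 3 * votes.countP (fun v => v.2 == none) then none
  else (List.finRange n).find? fun i => decide (3 * N ≤ 4 * agreeCount votes i)

/-- The law of the output of Find-Key-Row. -/
noncomputable def keyRowLaw {n : ℕ} (F : HashFamily n Bool) (b1 b2 : (Fin n → Bool) → PMF ℝ)
    (T : ℝ) (N : ℕ) (H : Fin n → Bool) : PMF (Option (Fin n × ℝ)) :=
  PMF.bind ((List.range N).mapM fun _ => voteLaw F b2 T H) fun votes =>
    match keyRowIndex N votes with
    | none => PMF.pure none
    | some i => (b1 H).bind fun a => PMF.pure (some (i, a))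

/-- The law of the output of Find-Heavy-Rows. -/
noncomputable def heavyRowsLaw {n τ : ℕ} (F : HashFamily n Bool) (G : HashFamily n (Fin τ))
    (b1 b2 : (Fin n → Bool) → PMF ℝ) (T : ℝ) (N : ℕ) (P : Fin n → Bool) :
    PMF (Finset (Fin n × ℝ)) :=
  G.law.bind fun H => PMF.bind ((List.finRange τ).mapM fun k =>
    keyRowLaw F b1 b2 T N (hadHash P fun i => decide (H i = k))) fun C =>
      PMF.pure (by classical exact C.reduceOption.toFinset)

/-- The law of the hash functions and of the heavy-row sets drawn by Recursive Sum. -/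
noncomputable def levelsLaw {n : ℕ} (F : HashFamily n Bool)
    (q : (Fin n → Bool) → PMF (Finset (Fin n × ℝ))) (φ : ℕ) :
    PMF (List (Fin n → Bool) × List (Finset (Fin n × ℝ))) :=
  PMF.bind ((List.range φ).mapM fun _ => F.law) fun hs =>
    PMF.bind ((List.range φ).mapM fun j => q (prefixHash hs j)) fun Qs => PMF.pure (hs, Qs)

open Classical in
/-- The output of Recursive Sum as a function of the hash functions and the heavy-row sets. -/
noncomputable def recursiveSumValue (g : ℝ → ℝ) {n : ℕ} (A : Matrix (Fin n) (Fin n) ℝ) (φ : ℕ)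
    (hs : List (Fin n → Bool)) (Qs : List (Finset (Fin n × ℝ))) : ℝ :=
  let V : Fin n → ℝ := rowWeight g (samplingIdentity (prefixHash hs φ) * A)
  if 10 ^ 10 < (Finset.univ.filter fun i => V i ≠ 0).card then 0
  else combineLevels hs Qs (∑ i, V i)

section Laws

open Alg

variable {n τ : ℕ} (F : HashFamily n Bool) (G : HashFamily n (Fin τ)) (BA1 BA2 : BlackBox n)
  (T : ℝ) (N φ : ℕ) (A : Matrix (Fin n) (Fin n) ℝ) (H P : Fin n → Bool)

theorem HashFamily.draw_hasOutput {β : Type} (F : HashFamily n β) : HasOutput F.draw F.law :=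
  HasOutput.alloc_bind <| (HasOutput.sample _).bind fun _ => HasOutput.pure _

theorem BlackBox.call_hasOutput (B : BlackBox n) : HasOutput (B.call A H) (B.run A H) :=
  HasOutput.alloc_bind (HasOutput.sample _)

theorem keyRowVote_hasOutput :
    HasOutput (keyRowVote F BA2 T A H) (voteLaw F (BA2.run A) T H) :=
  F.draw_hasOutput.bind fun _ => (BA2.call_hasOutput A _).bind fun _ =>
    (BA2.call_hasOutput A _).bind fun _ => HasOutput.pure _

theorem findKeyRow_hasOutput :
    HasOutput (findKeyRow F BA1 BA2 T N A H) (keyRowLaw F (BA1.run A) (BA2.run A) T N H) := by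
  refine (HasOutput.mapM (fun _ => keyRowVote_hasOutput F BA2 T A H) _).bind fun votes => ?_
  unfold keyRowIndex agreeCount
  split_ifs
  · exact HasOutput.pure _
  · cases (List.finRange n).find?
        (fun i => decide (3 * N ≤ 4 * votes.countP (fun v => v.2 == some (v.1 i)))) with
    | none => exact HasOutput.pure _
    | some i => exact (BA1.call_hasOutput A H).bind fun a => HasOutput.pure _

theorem findHeavyRows_hasOutput :
    HasOutput (findHeavyRows F G BA1 BA2 T N A P)
      (heavyRowsLaw F G (BA1.run A) (BA2.run A) T N P) :=
  G.draw_hasOutput.bind fun _ =>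
    (HasOutput.mapM (fun _ => findKeyRow_hasOutput F BA1 BA2 T N A _) _).bind fun _ =>
      HasOutput.pure _

theorem recursiveSum_hasOutput (g : ℝ → ℝ) :
    HasOutput (recursiveSum g F G BA1 BA2 T N φ A)
      ((levelsLaw F (heavyRowsLaw F G (BA1.run A) (BA2.run A) T N) φ).bind fun x =>
        PMF.pure (recursiveSumValue g A φ x.1 x.2)) := by
  unfold levelsLaw
  rw [PMF.bind_bind]
  refine (HasOutput.mapM (fun _ => F.draw_hasOutput) _).bind fun hs => ?_
  rw [PMF.bind_bind]
  refine (HasOutput.mapM (fun _ => findHeavyRows_hasOutput F G BA1 BA2 T N A _) _).bind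
    fun Qs => ?_
  rw [PMF.pure_bind]
  unfold recursiveSumValue
  dsimp only
  split_ifs
  · exact HasOutput.pure _
  · exact HasOutput.pure _

theorem HashFamily.draw_usesAtMost {β : Type} (F : HashFamily n β) : UsesAtMost F.draw F.bits :=
  ((UsesAtMost.alloc _).bind fun _ => (UsesAtMost.sample _).bind fun _ => UsesAtMost.pure _).mono
    (by omega)

theorem BlackBox.call_usesAtMost (B : BlackBox n) : UsesAtMost (B.call A H) B.space :=
  (UsesAtMost.alloc _).bind fun _ => UsesAtMost.sample _

theorem keyRowVote_usesAtMost :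
    UsesAtMost (keyRowVote F BA2 T A H) (F.bits + 2 * BA2.space) :=
  (F.draw_usesAtMost.bind fun _ => (BA2.call_usesAtMost A _).bind fun _ =>
    (BA2.call_usesAtMost A _).bind fun _ => UsesAtMost.pure _).mono (by omega)

theorem findKeyRow_usesAtMost :
    UsesAtMost (findKeyRow F BA1 BA2 T N A H)
      (N * (F.bits + 2 * BA2.space) + BA1.space) := by
  refine ((UsesAtMost.mapM (fun _ => keyRowVote_usesAtMost F BA2 T A H) _).bind
    (c := BA1.space) fun votes => ?_).mono (by simp)
  split_ifs
  · exact (UsesAtMost.pure _).mono (Nat.zero_le _)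
  · cases (List.finRange n).find?
        (fun i => decide (3 * N ≤ 4 * votes.countP (fun v => v.2 == some (v.1 i)))) with
    | none => exact (UsesAtMost.pure _).mono (Nat.zero_le _)
    | some i => exact (BA1.call_usesAtMost A H).bind fun a => UsesAtMost.pure _

theorem findHeavyRows_usesAtMost :
    UsesAtMost (findHeavyRows F G BA1 BA2 T N A P)
      (G.bits + τ * (N * (F.bits + 2 * BA2.space) + BA1.space)) :=
  (G.draw_usesAtMost.bind fun _ =>
    (UsesAtMost.mapM (fun _ => findKeyRow_usesAtMost F BA1 BA2 T N A _) _).bind fun _ =>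
      UsesAtMost.pure _).mono (by simp)

theorem recursiveSum_usesAtMost (g : ℝ → ℝ) :
    UsesAtMost (recursiveSum g F G BA1 BA2 T N φ A)
      (φ * F.bits + φ * (G.bits + τ * (N * (F.bits + 2 * BA2.space) + BA1.space))) := by
  refine ((UsesAtMost.mapM (fun _ => F.draw_usesAtMost) _).bind fun hs =>
    (UsesAtMost.mapM (fun _ => findHeavyRows_usesAtMost F G BA1 BA2 T N A _) _).bind
      (c := 0) fun Qs => ?_).mono (by simp)
  dsimp only
  split_ifs
  · exact UsesAtMost.pure _
  · exact UsesAtMost.pure _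

end Laws

/-! ### Lists of independent draws -/

namespace PMF

variable {α β : Type}

theorem mapM_cons_eq (f : α → PMF β) (x : α) (l : List α) :
    (x :: l).mapM f = (f x).bind fun y => PMF.bind (l.mapM f) fun ys => PMF.pure (y :: ys) :=
  List.mapM_cons

/-- Independence factors the exponential moment into one factor per trial. -/
theorem expect_pow_countP_le (p : PMF β) (S : β → Bool) {π c : ℝ} (hπ : 0 ≤ π) (hc : 1 ≤ c)
    (hS : (p.prob fun b => S b = true) ≤ ENNReal.ofReal π) (l : List α) :
    (PMF.expect (l.mapM fun _ => p) fun ys => ENNReal.ofReal (c ^ ys.countP S))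
      ≤ ENNReal.ofReal ((1 + π * (c - 1)) ^ l.length) := by
  have h1 : (p.expect fun y => ENNReal.ofReal (if S y then c else 1))
      ≤ ENNReal.ofReal (1 + π * (c - 1)) := by
    have h2 : ∀ y, ENNReal.ofReal (if S y then c else 1)
        = 1 + (if S y = true then 1 else 0) * ENNReal.ofReal (c - 1) := fun y => by
      split_ifs
      · rw [one_mul, ← ENNReal.ofReal_one, ← ENNReal.ofReal_add zero_le_one (by linarith)]
        congr 1
        ring
      · simp
    simp only [h2]
    rw [expect_add, expect_const, expect_mul_const,
      ENNReal.ofReal_add zero_le_one (mul_nonneg hπ (by linarith)), ENNReal.ofReal_one,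
      ENNReal.ofReal_mul hπ]
    gcongr
    rw [prob_eq_expect] at hS
    exact hS
  induction l with
  | nil =>
    change PMF.expect (PMF.pure []) _ ≤ _
    simp [expect_pure]
  | cons x l ih =>
    rw [mapM_cons_eq, expect_bind]
    simp only [expect_bind, expect_pure]
    have h3 : ∀ (y : β) (ys : List β), ENNReal.ofReal (c ^ (y :: ys).countP S)
        = ENNReal.ofReal (if S y then c else 1) * ENNReal.ofReal (c ^ ys.countP S) := by
      intro y ys
      rw [← ENNReal.ofReal_mul (by split_ifs <;> linarith), List.countP_cons]
      congr 1
      split_ifs <;> ring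
    simp only [h3, expect_const_mul, expect_mul_const]
    rw [List.length_cons, pow_succ', ENNReal.ofReal_mul (by nlinarith)]
    exact mul_le_mul' h1 ih

/-- A Chernoff bound for the number of successes among independent trials. -/
theorem prob_le_countP_le (p : PMF β) (S : β → Bool) {π t : ℝ} (hπ : 0 ≤ π) (ht : 1 ≤ t)
    (hS : (p.prob fun b => S b = true) ≤ ENNReal.ofReal π) (l : List α) (a : ℕ) :
    (PMF.prob (l.mapM fun _ => p) fun ys => a * l.length ≤ 4 * ys.countP S)
      ≤ ENNReal.ofReal (((1 + π * (t ^ 4 - 1)) / t ^ a) ^ l.length) := by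
  -- Markov's inequality for the exponential moment. The base is `t ^ 4` because the threshold is a
  -- quarter of `a * l.length`; all exponents stay natural numbers.
  have h := (prob_mul_le_expect (l.mapM fun _ => p)
    (fun ys => a * l.length ≤ 4 * ys.countP S) _ (ENNReal.ofReal (t ^ (a * l.length)))
    fun ys hys => ?_).trans
      (expect_pow_countP_le p S (c := t ^ 4) hπ (one_le_pow₀ ht) hS l)
  · have ht' : 0 < t ^ (a * l.length) := by positivity
    rw [div_pow, ← pow_mul, ENNReal.ofReal_div_of_pos ht']
    exact (ENNReal.le_div_iff_mul_le (Or.inl (by simpa using ht')) (Or.inl ENNReal.ofReal_ne_top)).2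
      h
  · refine ENNReal.ofReal_le_ofReal ?_
    rw [← pow_mul]
    exact pow_le_pow_right₀ ht hys

/-- A union bound over the members of a list of independent draws. -/
theorem prob_not_forall₂_mapM (f : α → PMF β) (R : α → β → Prop) {c : ℝ≥0∞}
    (h : ∀ x, ((f x).prob fun y => ¬ R x y) ≤ c) (l : List α) :
    (PMF.prob (l.mapM f) fun ys => ¬ List.Forall₂ R l ys) ≤ l.length * c := by
  classical
  induction l with
  | nil =>
    change PMF.prob (PMF.pure []) _ ≤ _
    simp [prob_pure]
  | cons x l ih =>
    rw [mapM_cons_eq]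
    refine (prob_bind_le_add _ _ (fun y => ¬ R x y) _ (l.length * c) fun y hy => ?_).trans ?_
    · refine le_trans ?_ ih
      rw [prob_bind, prob_eq_expect]
      refine expect_mono _ fun ys => ?_
      have h1 : (¬ List.Forall₂ R (x :: l) (y :: ys)) ↔ ¬ List.Forall₂ R l ys := by
        simp [not_not.1 hy]
      rw [prob_pure, if_congr h1 rfl rfl]
    · rw [List.length_cons, Nat.cast_succ, add_mul, one_mul, add_comm]
      gcongr
      exact h x

end PMF

/-! ### Row weights -/

/-- The total weight of the rows sampled by `H`. -/
noncomputable def sampledSum {n : ℕ} (u : Fin n → ℝ) (H : Fin n → Bool) : ℝ :=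
  ∑ i, if H i then u i else 0

theorem samplingIdentity_mul_apply {n : ℕ} (H : Fin n → Bool) (A : Matrix (Fin n) (Fin n) ℝ)
    (i j : Fin n) : (samplingIdentity H * A) i j = if H i then A i j else 0 := by
  simp [samplingIdentity, Matrix.diagonal_mul]

theorem rowWeight_samplingIdentity {g : ℝ → ℝ} (hg : IsHadamardFunction g) {n : ℕ}
    (H : Fin n → Bool) (A : Matrix (Fin n) (Fin n) ℝ) (i : Fin n) :
    rowWeight g (samplingIdentity H * A) i = if H i then rowWeight g A i else 0 := by
  simp only [rowWeight, samplingIdentity_mul_apply]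
  split_ifs <;> simp [hg.zero]

theorem hadamardNorm_samplingIdentity {g : ℝ → ℝ} (hg : IsHadamardFunction g) {n : ℕ}
    (H : Fin n → Bool) (A : Matrix (Fin n) (Fin n) ℝ) :
    hadamardNorm g (samplingIdentity H * A) = sampledSum (rowWeight g A) H :=
  Finset.sum_congr rfl fun i _ => rowWeight_samplingIdentity hg H A i

theorem rowWeight_nonneg {g : ℝ → ℝ} (hg : IsHadamardFunction g) {n : ℕ}
    (A : Matrix (Fin n) (Fin n) ℝ) (i : Fin n) : 0 ≤ rowWeight g A i :=
  Finset.sum_nonneg fun _ _ => hg.nonneg _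

namespace IsHadamardFunction

theorem map_sum_le {g : ℝ → ℝ} (hg : IsHadamardFunction g) {ι : Type} (s : Finset ι)
    (x : ι → ℝ) : g (∑ i ∈ s, x i) ≤ ∑ i ∈ s, g (x i) := by
  classical
  induction s using Finset.induction_on with
  | empty => simp [hg.zero]
  | insert i s hi ih =>
    rw [Finset.sum_insert hi, Finset.sum_insert hi]
    exact (hg.subadditive _ _).trans (by gcongr)

/-- The reverse triangle inequality; evenness allows `y` to be subtracted again at cost `g y`. -/
theorem abs_sub_le {g : ℝ → ℝ} (hg : IsHadamardFunction g) (x y : ℝ) :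
    |g (x + y) - g x| ≤ g y := by
  have h1 := hg.subadditive x y
  have h2 := hg.subadditive (x + y) (-y)
  rw [hg.even, add_neg_cancel_right] at h2
  exact abs_le.2 ⟨by linarith, by linarith⟩

/-- The aggregate of the sampled rows is governed by a single row up to the weight of the others. -/
theorem abs_aggregate_sub_le {g : ℝ → ℝ} (hg : IsHadamardFunction g) {n : ℕ}
    (H : Fin n → Bool) (A : Matrix (Fin n) (Fin n) ℝ) (i : Fin n) :
    |hadamardNorm g (rowAggregation n * (samplingIdentity H * A))
        - (if H i then rowWeight g A i else 0)|
      ≤ sampledSum (rowWeight g A) H - (if H i then rowWeight g A i else 0) := by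
  rw [← hadamardNorm_samplingIdentity hg, ← rowWeight_samplingIdentity hg]
  set B := samplingIdentity H * A
  have h1 : hadamardNorm g (rowAggregation n * B) = ∑ j, g (∑ k, B k j) := by
    simp [hadamardNorm, rowAggregation, Matrix.mul_apply]
  have h2 : hadamardNorm g B - rowWeight g B i
      = ∑ j, ∑ k ∈ Finset.univ.erase i, g (B k j) := by
    unfold hadamardNorm rowWeight
    rw [Finset.sum_comm, ← Finset.sum_sub_distrib]
    refine Finset.sum_congr rfl fun j _ => ?_
    rw [← Finset.add_sum_erase _ _ (Finset.mem_univ i), add_sub_cancel_left]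
  rw [h1, h2, rowWeight, ← Finset.sum_sub_distrib]
  refine (Finset.abs_sum_le_sum_abs _ _).trans (Finset.sum_le_sum fun j _ => ?_)
  rw [← Finset.add_sum_erase _ _ (Finset.mem_univ i)]
  exact (hg.abs_sub_le _ _).trans (hg.map_sum_le _ _)

end IsHadamardFunction

section SampledSum

variable {n : ℕ} {u : Fin n → ℝ}

theorem sampledSum_nonneg (hu : ∀ i, 0 ≤ u i) (H : Fin n → Bool) : 0 ≤ sampledSum u H :=
  Finset.sum_nonneg fun i _ => by split_ifs <;> simp [hu]

theorem sampledSum_split (H Hl : Fin n → Bool) :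
    sampledSum u (hadHash H Hl) + sampledSum u (hadHash H (complHash Hl)) = sampledSum u H := by
  unfold sampledSum
  rw [← Finset.sum_add_distrib]
  refine Finset.sum_congr rfl fun i _ => ?_
  cases h : H i <;> cases h' : Hl i <;> simp [hadHash, complHash, h, h']

theorem sampled_le_sampledSum (hu : ∀ i, 0 ≤ u i) (H : Fin n → Bool) (i : Fin n) :
    (if H i then u i else 0) ≤ sampledSum u H :=
  Finset.single_le_sum (f := fun i => if H i then u i else 0)
    (fun i _ => by split_ifs <;> simp [hu]) (Finset.mem_univ i)

/-- The weight of the sampled rows that `Hl` separates from row `i`. -/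
theorem separated_eq (H Hl : Fin n → Bool) (i : Fin n) :
    (∑ j ∈ Finset.univ.erase i, (if H j then u j else 0) * (if Hl j = Hl i then (0 : ℝ) else 1))
      = if Hl i then sampledSum u (hadHash H (complHash Hl)) else sampledSum u (hadHash H Hl) := by
  have h0 := Finset.add_sum_erase (Finset.univ)
    (fun j => (if H j then u j else 0) * (if Hl j = Hl i then (0 : ℝ) else 1)) (Finset.mem_univ i)
  simp only [if_true, mul_zero, zero_add] at h0
  rw [h0]
  unfold sampledSum
  cases hi : Hl i
  · refine Finset.sum_congr rfl fun j _ => ?_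
    cases h : H j <;> cases h' : Hl j <;> simp [hadHash, h, h']
  · refine Finset.sum_congr rfl fun j _ => ?_
    cases h : H j <;> cases h' : Hl j <;> simp [hadHash, complHash, h, h']

/-- Each other row is separated from row `i` with probability 1/2, by pairwise independence. -/
theorem mean_separated {F : HashFamily n Bool} (hF : F.PairwiseIndependent) (H : Fin n → Bool)
    (i : Fin n) :
    (F.mean fun Hl => ∑ j ∈ Finset.univ.erase i,
        (if H j then u j else 0) * (if Hl j = Hl i then (0 : ℝ) else 1))
      = (sampledSum u H - if H i then u i else 0) / 2 := by
  rw [HashFamily.mean_sum]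
  have h1 : sampledSum u H - (if H i then u i else 0)
      = ∑ j ∈ Finset.univ.erase i, if H j then u j else 0 := by
    unfold sampledSum
    rw [← Finset.add_sum_erase _ _ (Finset.mem_univ i), add_sub_cancel_left]
  rw [h1, Finset.sum_div]
  refine Finset.sum_congr rfl fun j hj => ?_
  rw [HashFamily.mean_const_mul, HashFamily.mean_apply_apply hF (Finset.ne_of_mem_erase hj)
    fun a b => if a = b then 0 else 1]
  norm_num
  split_ifs <;> ring

end SampledSum

/-! ### Find-Key-Row -/

section Vote

variable {n : ℕ} {u : Fin n → ℝ} {r η : ℝ} {b2 : (Fin n → Bool) → PMF ℝ} {F : HashFamily n Bool}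

/-- Write v for the sampled weight of row `i` and R for that of the other rows. A vote for a side
makes the true weights x and x' of the winning and losing sides satisfy 50 x' ≤ η x, as the two
approximations lose r². Since x ≤ v + R and η v ≤ 4 R, the right side is at most 5 R. -/
theorem agree_imp_separated_le (hu : ∀ i, 0 ≤ u i) (hr : 1 ≤ r) (hη : 0 < η) (hη1 : η ≤ 1)
    {H Hl : Fin n → Bool} {y1 y0 : ℝ}
    (h1 : IsFactorApprox r y1 (sampledSum u (hadHash H Hl)))
    (h0 : IsFactorApprox r y0 (sampledSum u (hadHash H (complHash Hl)))) (i : Fin n)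
    (hi : η * (if H i then u i else 0) ≤ 4 * (sampledSum u H - if H i then u i else 0))
    (hv : voteValue (50 * r ^ 2 / η) y1 y0 = some (Hl i)) :
    (if Hl i then sampledSum u (hadHash H (complHash Hl)) else sampledSum u (hadHash H Hl))
      ≤ (sampledSum u H - if H i then u i else 0) / 10 := by
  have hr0 : 0 < r := by linarith
  have key : ∀ x x' y y' : ℝ, 0 ≤ x → 0 ≤ x' → IsFactorApprox r y x → IsFactorApprox r y' x' →
      x + x' = sampledSum u H → 50 * r ^ 2 / η * y' ≤ y →
      x' ≤ (sampledSum u H - if H i then u i else 0) / 10 := by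
    intro x x' y y' hx hx' hy hy' hs hT
    have e1 : 50 * r ^ 2 / η * (x' / r) ≤ r * x :=
      (mul_le_mul_of_nonneg_left hy'.1 (by positivity)).trans (hT.trans hy.2)
    have e2 : 50 * r ^ 2 / η * (x' / r) = r * (50 / η * x') := by field_simp
    rw [e2] at e1
    have e3 : 50 / η * x' ≤ x := le_of_mul_le_mul_left e1 hr0
    have e4 : 50 * x' ≤ η * x := by
      have := mul_le_mul_of_nonneg_left e3 hη.le
      rwa [← mul_assoc, mul_div_cancel₀ _ hη.ne'] at this
    have hle := sampled_le_sampledSum hu H i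
    nlinarith
  have hx1 := sampledSum_nonneg hu (hadHash H Hl)
  have hx0 := sampledSum_nonneg hu (hadHash H (complHash Hl))
  have hs := sampledSum_split (u := u) H Hl
  unfold voteValue at hv
  cases hi' : Hl i
  · rw [hi'] at hv
    split_ifs at hv with c1 c2
    · simpa using key _ _ _ _ hx0 hx1 h0 h1 (by rw [add_comm, hs]) c1
    · simp at hv
  · rw [hi'] at hv
    split_ifs at hv with c1 c2
    · simp at hv
    · simpa using key _ _ _ _ hx1 hx0 h1 h0 hs c2

/-- The factor r⁴ covers the r² in the threshold and the r² lost in the two estimates. Since the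
vote tests `some false` first, a vote for `true` also requires the reverse comparison to fail; this
is where positivity of the row and a threshold above 1 enter. -/
theorem keyRow_imp_agree (hu : ∀ i, 0 ≤ u i) (hr : 1 ≤ r) (hη : 0 < η) (hη1 : η ≤ 1)
    {H Hl : Fin n → Bool} {y1 y0 : ℝ}
    (h1 : IsFactorApprox r y1 (sampledSum u (hadHash H Hl)))
    (h0 : IsFactorApprox r y0 (sampledSum u (hadHash H (complHash Hl)))) (i : Fin n)
    (hpos : 0 < if H i then u i else 0)
    (hi : 50 * r ^ 4 / η * (sampledSum u H - if H i then u i else 0) ≤ if H i then u i else 0) :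
    voteValue (50 * r ^ 2 / η) y1 y0 = some (Hl i) := by
  have hr0 : 0 < r := by linarith
  have hT : 1 < 50 * r ^ 2 / η := by
    rw [lt_div_iff₀ hη]
    nlinarith
  have key : ∀ x x' y y' : ℝ, IsFactorApprox r y x → IsFactorApprox r y' x' →
      x + x' = sampledSum u H → (if H i then u i else 0) ≤ x →
      50 * r ^ 2 / η * y' ≤ y ∧ ¬ 50 * r ^ 2 / η * y ≤ y' := by
    intro x x' y y' hy hy' hs hx
    have e1 : 50 * r ^ 2 / η * y' ≤ 50 * r ^ 2 / η * (r * x') :=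
      mul_le_mul_of_nonneg_left hy'.2 (by positivity)
    have e2 : 50 * r ^ 2 / η * (r * x') = (50 * r ^ 4 / η * x') / r := by field_simp
    have e3 : 50 * r ^ 4 / η * x' ≤ x :=
      (mul_le_mul_of_nonneg_left (by linarith) (by positivity)).trans (hi.trans hx)
    have e4 : 50 * r ^ 2 / η * y' ≤ y := by
      rw [e2] at e1
      exact e1.trans ((div_le_div_of_nonneg_right e3 hr0.le).trans hy.1)
    have e5 : 0 < y := lt_of_lt_of_le (div_pos (hpos.trans_le hx) hr0) hy.1
    refine ⟨e4, fun e6 => ?_⟩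
    have e7 := mul_lt_mul_of_pos_right hT e5
    have e8 : 1 * y' ≤ 50 * r ^ 2 / η * y' := by
      have : 0 < y' := by linarith
      gcongr
    linarith
  have hs := sampledSum_split (u := u) H Hl
  have hle : (if H i then u i else 0)
      ≤ if Hl i then sampledSum u (hadHash H Hl) else sampledSum u (hadHash H (complHash Hl)) := by
    split_ifs with h2 h3 h3
    · simpa [hadHash, h2, h3] using sampled_le_sampledSum hu (hadHash H Hl) i
    · simpa [hadHash, complHash, h2, h3] using
        sampled_le_sampledSum hu (hadHash H (complHash Hl)) i
    · exact sampledSum_nonneg hu _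
    · exact sampledSum_nonneg hu _
  unfold voteValue
  cases hi' : Hl i
  · rw [hi'] at hle
    have := key _ _ _ _ h0 h1 (by rw [add_comm, hs]) (by simpa using hle)
    rw [if_pos this.1]
  · rw [hi'] at hle
    have := key _ _ _ _ h1 h0 hs (by simpa using hle)
    rw [if_neg this.2, if_pos this.1]

/-- Reduces a statement on votes to one on the hash function alone, at the cost of one failure
probability for each of the two norm estimates. -/
theorem voteLaw_prob_le {δ : ℝ} {T : ℝ}
    (hb2 : ∀ H, ((b2 H).prob fun y => ¬ IsFactorApprox r y (sampledSum u H)) ≤ ENNReal.ofReal δ)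
    (H : Fin n → Bool) (S : (Fin n → Bool) → Option Bool → Prop) (E : (Fin n → Bool) → Prop)
    [DecidablePred E]
    (hS : ∀ Hl y1 y0, IsFactorApprox r y1 (sampledSum u (hadHash H Hl)) →
      IsFactorApprox r y0 (sampledSum u (hadHash H (complHash Hl))) →
      S Hl (voteValue T y1 y0) → E Hl) :
    ((voteLaw F b2 T H).prob fun v => S v.1 v.2)
      ≤ F.law.prob E + (ENNReal.ofReal δ + ENNReal.ofReal δ) := by
  classical
  refine PMF.prob_bind_le_add _ _ _ _ _ fun Hl hE => ?_
  refine (PMF.prob_bind_le_add _ _ _ _ (ENNReal.ofReal δ) fun y1 h1 => ?_).trans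
    (add_le_add (hb2 (hadHash H Hl)) le_rfl)
  refine (PMF.prob_bind_le_add _ _ _ _ 0 fun y0 h0 => ?_).trans
    ((add_zero _).trans_le (hb2 (hadHash H (complHash Hl))))
  rw [PMF.prob_pure, if_neg]
  exact fun h => hE (hS Hl y1 y0 (not_not.1 h1) (not_not.1 h0) h)

theorem prob_agree_le (hF : F.PairwiseIndependent) (hu : ∀ i, 0 ≤ u i) (hr : 1 ≤ r) (hη : 0 < η)
    (hη1 : η ≤ 1)
    (hb2 : ∀ H, ((b2 H).prob fun y => ¬ IsFactorApprox r y (sampledSum u H))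
      ≤ ENNReal.ofReal (1 / 100))
    (H : Fin n → Bool) (i : Fin n)
    (hi : 4 * (sampledSum u H - if H i then u i else 0) > η * (if H i then u i else 0)) :
    ((voteLaw F b2 (50 * r ^ 2 / η) H).prob fun v => (v.2 == some (v.1 i)) = true)
      ≤ ENNReal.ofReal (3 / 5) := by
  classical
  set R := sampledSum u H - if H i then u i else 0 with hR
  have hv : 0 ≤ if H i then u i else 0 := by split_ifs <;> simp [hu]
  have hR0 : 0 < R := by nlinarith
  set Z : (Fin n → Bool) → ℝ := fun Hl => ∑ j ∈ Finset.univ.erase i,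
        (if H j then u j else 0) * (if Hl j = Hl i then (0 : ℝ) else 1) with hZ
  have hZR : ∀ Hl, Z Hl ≤ R := fun Hl => by
    have h1 : R = ∑ j ∈ Finset.univ.erase i, if H j then u j else 0 := by
      rw [hR]
      unfold sampledSum
      rw [← Finset.add_sum_erase _ _ (Finset.mem_univ i), add_sub_cancel_left]
    rw [h1]
    refine Finset.sum_le_sum fun j _ => ?_
    have := hu j
    split_ifs <;> simp [this]
  -- Markov's inequality for `R - Z`, which is non-negative with mean `R / 2` and is at least `9 * R
  -- / 10` on this event.
  have hE : F.law.prob (fun Hl => Z Hl ≤ R / 10) ≤ ENNReal.ofReal (5 / 9) := by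
    have h1 := PMF.prob_mul_le_expect F.law (fun Hl => Z Hl ≤ R / 10)
      (fun Hl => ENNReal.ofReal ((10 / (9 * R)) * (R - Z Hl))) 1 fun Hl h => by
        rw [← ENNReal.ofReal_one]
        refine ENNReal.ofReal_le_ofReal ?_
        rw [div_mul_eq_mul_div, le_div_iff₀ (by positivity)]
        linarith
    rw [mul_one, HashFamily.law_expect _ _ fun Hl =>
      mul_nonneg (by positivity) (by linarith [hZR Hl])] at h1
    refine h1.trans (ENNReal.ofReal_le_ofReal ?_)
    rw [HashFamily.mean_const_mul, HashFamily.mean_sub, HashFamily.mean_const, hZ,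
      mean_separated hF H i, ← hR]
    apply le_of_eq
    field_simp
    norm_num
  refine (voteLaw_prob_le hb2 H (fun Hl b => (b == some (Hl i)) = true)
    (fun Hl => Z Hl ≤ R / 10) fun Hl y1 y0 h1 h0 h => ?_).trans ?_
  · rw [hZ]
    simp only
    rw [separated_eq]
    exact agree_imp_separated_le hu hr hη hη1 h1 h0 i hi.le (by simpa using h)
  · refine (add_le_add hE le_rfl).trans ?_
    rw [← ENNReal.ofReal_add (by norm_num) (by norm_num),
      ← ENNReal.ofReal_add (by norm_num) (by norm_num)]
    exact ENNReal.ofReal_le_ofReal (by norm_num)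

theorem prob_disagree_le (hu : ∀ i, 0 ≤ u i) (hr : 1 ≤ r) (hη : 0 < η) (hη1 : η ≤ 1)
    (hb2 : ∀ H, ((b2 H).prob fun y => ¬ IsFactorApprox r y (sampledSum u H))
      ≤ ENNReal.ofReal (1 / 100))
    (H : Fin n → Bool) (i : Fin n) (hpos : 0 < if H i then u i else 0)
    (hi : 50 * r ^ 4 / η * (sampledSum u H - if H i then u i else 0) ≤ if H i then u i else 0) :
    ((voteLaw F b2 (50 * r ^ 2 / η) H).prob fun v => (!(v.2 == some (v.1 i))) = true)
      ≤ ENNReal.ofReal (1 / 50) := by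
  classical
  refine (voteLaw_prob_le hb2 H (fun Hl b => (!(b == some (Hl i))) = true)
    (fun Hl => False) fun Hl y1 y0 h1 h0 h => ?_).trans ?_
  · simp [keyRow_imp_agree hu hr hη hη1 h1 h0 i hpos hi] at h
  · rw [PMF.prob_eq_expect]
    simp only [if_false, PMF.expect_const, zero_add]
    rw [← ENNReal.ofReal_add (by norm_num) (by norm_num)]
    exact ENNReal.ofReal_le_ofReal (by norm_num)

/-- The conclusions that Find-Key-Row has to satisfy on the rows sampled by `H`: a reported weight
is accurate, and a row that dominates all the others is reported. -/
def KeyRowCorrect (u : Fin n → ℝ) (r η : ℝ) (H : Fin n → Bool) (o : Option (Fin n × ℝ)) : Prop :=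
  (∀ i w, o = some (i, w) → |w - if H i then u i else 0| ≤ η * if H i then u i else 0) ∧
  ∀ i, (0 < if H i then u i else 0) →
    50 * r ^ 4 / η * (sampledSum u H - if H i then u i else 0) ≤ (if H i then u i else 0) →
    ∃ w, o = some (i, w)

theorem countP_not_add {β : Type} (S : β → Bool) (l : List β) :
    l.countP S + l.countP (fun b => !S b) = l.length :=
  (List.length_eq_countP_add_countP S (l := l)).symm ▸ by simp

/-- A key row collects 3/4 of the votes, so at most 1/4 abstain and the 2/3 test does not trigger.
The search may stop at an earlier row, but any row it returns satisfies `Dom`, and `huniq`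
identifies it with the key row. -/
theorem keyRowIndex_spec {N : ℕ} (hN : 0 < N) {votes : List ((Fin n → Bool) × Option Bool)}
    (hlen : votes.length = N) (Dom Key : Fin n → Prop)
    (hdom : ∀ i, ¬ Dom i → ¬ 3 * N ≤ 4 * agreeCount votes i)
    (hkey : ∀ i, Key i → 3 * N ≤ 4 * agreeCount votes i)
    (huniq : ∀ i j, Key i → Dom j → j = i) :
    (∀ i, keyRowIndex N votes = some i → Dom i) ∧
      ∀ i, Key i → keyRowIndex N votes = some i := by
  have h1 : ∀ i, keyRowIndex N votes = some i → Dom i := fun i hi => by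
    unfold keyRowIndex at hi
    split_ifs at hi
    have := List.find?_some hi
    by_contra hd
    exact hdom i hd (by simpa using this)
  refine ⟨h1, fun i hi => ?_⟩
  have h2 : ∃ j, keyRowIndex N votes = some j := by
    unfold keyRowIndex
    rw [if_neg]
    · rw [← Option.isSome_iff_exists, List.find?_isSome]
      exact ⟨i, List.mem_finRange i, by simpa using hkey i hi⟩
    · have h3 := hkey i hi
      have h4 := countP_not_add (fun v : (Fin n → Bool) × Option Bool => v.2 == some (v.1 i)) votes
      have h5 : votes.countP (fun v => v.2 == none)
          ≤ votes.countP (fun v => !(v.2 == some (v.1 i))) := by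
        refine List.countP_mono_left fun v _ hv => ?_
        have hv' : v.2 = none := by simpa using hv
        simp [hv']
      unfold agreeCount at h3
      omega
  obtain ⟨j, hj⟩ := h2
  rw [hj, huniq i j hi (h1 j hj)]

/-- The relative errors η/4 (other rows) and η/2 (black box) compose to at most 3η/4 + η²/8, which
is below η. -/
theorem abs_sub_le_of_dominant {η a v R w : ℝ} (hη : 0 < η) (hη1 : η ≤ 1) (hv : 0 ≤ v)
    (ha : |a - v| ≤ R) (hR : 4 * R ≤ η * v) (hw : IsRelApprox (η / 2) w a) : |w - v| ≤ η * v := by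
  obtain ⟨h1, h2⟩ := hw
  obtain ⟨h3, h4⟩ := abs_le.1 ha
  have h5 : a ≤ (1 + η / 4) * v := by linarith
  have h6 : (1 - η / 4) * v ≤ a := by linarith
  have h7 := mul_le_mul_of_nonneg_left h5 (by linarith : 0 ≤ 1 + η / 2)
  have h8 := mul_le_mul_of_nonneg_left h6 (by linarith : 0 ≤ 1 - η / 2)
  have h9 : η * η * v ≤ η * v := by
    have : η * η ≤ η * 1 := by gcongr
    nlinarith
  have h10 : 0 ≤ η * η * v := by positivity
  exact abs_le.2 ⟨by nlinarith, by nlinarith⟩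

theorem agreeCount_chernoff (hF : F.PairwiseIndependent) (hu : ∀ i, 0 ≤ u i) (hr : 1 ≤ r)
    (hη : 0 < η) (hη1 : η ≤ 1)
    (hb2 : ∀ H, ((b2 H).prob fun y => ¬ IsFactorApprox r y (sampledSum u H))
      ≤ ENNReal.ofReal (1 / 100))
    (H : Fin n → Bool) (i : Fin n)
    (hi : 4 * (sampledSum u H - if H i then u i else 0) > η * (if H i then u i else 0)) (N : ℕ) :
    (PMF.prob ((List.range N).mapM fun _ => voteLaw F b2 (50 * r ^ 2 / η) H) fun votes =>
      3 * N ≤ 4 * agreeCount votes i) ≤ ENNReal.ofReal ((24 / 25) ^ N) := by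
  -- With success probability 3/5 and threshold 3/4, the tilt 5/4 gives a factor of about 0.955 per
  -- vote, below 24/25.
  have h := PMF.prob_le_countP_le _ _ (by norm_num) (by norm_num : (1 : ℝ) ≤ 5 / 4)
    (prob_agree_le hF hu hr hη hη1 hb2 H i hi) (List.range N) 3
  rw [List.length_range] at h
  exact h.trans (ENNReal.ofReal_le_ofReal
    (pow_le_pow_left₀ (by norm_num) (by norm_num) N))

theorem disagreeCount_chernoff (hu : ∀ i, 0 ≤ u i) (hr : 1 ≤ r)
    (hη : 0 < η) (hη1 : η ≤ 1)
    (hb2 : ∀ H, ((b2 H).prob fun y => ¬ IsFactorApprox r y (sampledSum u H))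
      ≤ ENNReal.ofReal (1 / 100))
    (H : Fin n → Bool) (i : Fin n) (hpos : 0 < if H i then u i else 0)
    (hi : 50 * r ^ 4 / η * (sampledSum u H - if H i then u i else 0) ≤ if H i then u i else 0)
    (N : ℕ) :
    (PMF.prob ((List.range N).mapM fun _ => voteLaw F b2 (50 * r ^ 2 / η) H) fun votes =>
      N ≤ 4 * votes.countP fun v => !(v.2 == some (v.1 i))) ≤ ENNReal.ofReal ((24 / 25) ^ N) := by
  have h := PMF.prob_le_countP_le _ _ (by norm_num) (by norm_num : (1 : ℝ) ≤ 2)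
    (prob_disagree_le (F := F) hu hr hη hη1 hb2 H i hpos hi) (List.range N) 1
  rw [List.length_range, one_mul] at h
  exact h.trans (ENNReal.ofReal_le_ofReal
    (pow_le_pow_left₀ (by norm_num) (by norm_num) N))

theorem keyRowLaw_prob_le {b1 : (Fin n → Bool) → PMF ℝ} {a : (Fin n → Bool) → ℝ} {d : ℝ≥0∞}
    (hF : F.PairwiseIndependent) (hu : ∀ i, 0 ≤ u i) (hr : 1 ≤ r) (hη : 0 < η) (hη1 : η ≤ 1)
    (ha : ∀ (H : Fin n → Bool) i,
      |a H - if H i then u i else 0| ≤ sampledSum u H - if H i then u i else 0)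
    (hb1 : ∀ H, ((b1 H).prob fun y => ¬ IsRelApprox (η / 2) y (a H)) ≤ d)
    (hb2 : ∀ H, ((b2 H).prob fun y => ¬ IsFactorApprox r y (sampledSum u H))
      ≤ ENNReal.ofReal (1 / 100))
    {N : ℕ} (hN : 0 < N) (H : Fin n → Bool) :
    ((keyRowLaw F b1 b2 (50 * r ^ 2 / η) N H).prob fun o => ¬ KeyRowCorrect u r η H o)
      ≤ ENNReal.ofReal (2 * n * (24 / 25) ^ N) + d := by
  classical
  set v : Fin n → ℝ := fun i => if H i then u i else 0 with hv
  have hv0 : ∀ i, 0 ≤ v i := fun i => by simp only [hv]; split_ifs <;> simp [hu]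
  set Dom : Fin n → Prop := fun i => 4 * (sampledSum u H - v i) ≤ η * v i with hDom
  set Key : Fin n → Prop := fun i =>
    0 < v i ∧ 50 * r ^ 4 / η * (sampledSum u H - v i) ≤ v i with hKey
  set p : PMF (List ((Fin n → Bool) × Option Bool)) :=
    (List.range N).mapM fun _ => voteLaw F b2 (50 * r ^ 2 / η) H with hp
  -- For distinct rows, `Key i` gives `50 * v j ≤ v i` while `Dom j` gives `4 * v i ≤ v j`,
  -- contradicting `0 < v i`.
  have huniq : ∀ i j, Key i → Dom j → j = i := by
    intro i j hi hj
    by_contra hne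
    have h2 : v i + v j ≤ sampledSum u H := by
      rw [← Finset.sum_pair (Ne.symm hne)]
      exact Finset.sum_le_sum_of_subset_of_nonneg (Finset.subset_univ _) fun k _ _ => hv0 k
    have h3 : 50 * v j ≤ v i := by
      refine le_trans ?_ hi.2
      have h4 : 50 ≤ 50 * r ^ 4 / η := by
        rw [le_div_iff₀ hη]
        nlinarith [one_le_pow₀ hr (n := 4)]
      exact mul_le_mul h4 (by linarith) (hv0 j) (by linarith)
    have h5 : 4 * v i ≤ v j := by
      have := hj
      simp only [hDom] at this
      nlinarith [hv0 j]
    linarith [hi.1, hv0 j]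
  -- The first alternative, with a trivial relation, has probability zero; excluding it records that
  -- the list of votes has length `N`.
  set B : List ((Fin n → Bool) × Option Bool) → Prop := fun votes =>
    (¬ List.Forall₂ (fun _ _ => True) (List.range N) votes) ∨
      (∃ i, ¬ Dom i ∧ 3 * N ≤ 4 * agreeCount votes i) ∨
      ∃ i, Key i ∧ N ≤ 4 * votes.countP fun v => !(v.2 == some (v.1 i)) with hB
  have hprob : p.prob B ≤ ENNReal.ofReal (2 * n * (24 / 25) ^ N) := by
    have e1 : p.prob (fun votes => ¬ List.Forall₂ (fun _ _ => True) (List.range N) votes) ≤ 0 := by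
      refine (PMF.prob_not_forall₂_mapM _ _ (c := 0) (fun _ => ?_) _).trans (by simp)
      simp [PMF.prob]
    have e2 : p.prob (fun votes => ∃ i, ¬ Dom i ∧ 3 * N ≤ 4 * agreeCount votes i)
        ≤ n * ENNReal.ofReal ((24 / 25) ^ N) := by
      refine (PMF.prob_exists _ _).trans ((Finset.sum_le_card_nsmul _ _
        (ENNReal.ofReal ((24 / 25) ^ N)) fun i _ => ?_).trans (by simp))
      by_cases hi : Dom i
      · simp [hi, PMF.prob]
      · exact (PMF.prob_mono _ fun _ h => h.2).trans
          (agreeCount_chernoff hF hu hr hη hη1 hb2 H i (not_le.1 hi) N)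
    have e3 : p.prob (fun votes => ∃ i, Key i ∧
          N ≤ 4 * votes.countP fun v => !(v.2 == some (v.1 i)))
        ≤ n * ENNReal.ofReal ((24 / 25) ^ N) := by
      refine (PMF.prob_exists _ _).trans ((Finset.sum_le_card_nsmul _ _
        (ENNReal.ofReal ((24 / 25) ^ N)) fun i _ => ?_).trans (by simp))
      by_cases hi : Key i
      · exact (PMF.prob_mono _ fun _ h => h.2).trans
          (disagreeCount_chernoff hu hr hη hη1 hb2 H i hi.1 hi.2 N)
      · simp [hi, PMF.prob]
    refine (PMF.prob_or _ _ _).trans ((add_le_add e1 ((PMF.prob_or _ _ _).trans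
      (add_le_add e2 e3))).trans ?_)
    rw [zero_add, ← two_mul, mul_assoc, ENNReal.ofReal_mul (by norm_num),
      ENNReal.ofReal_mul (by positivity)]
    simp
  refine (PMF.prob_bind_le_add p _ B _ d fun votes hvotes => ?_).trans (add_le_add hprob le_rfl)
  simp only [hB, not_or, not_not, not_exists, not_and] at hvotes
  obtain ⟨g1, g2, g3⟩ := hvotes
  have hlen : votes.length = N := by simpa using g1.length_eq.symm
  have hspec := keyRowIndex_spec hN hlen Dom Key g2 (fun i hi => by
    have h4 := countP_not_add (fun v : (Fin n → Bool) × Option Bool => v.2 == some (v.1 i)) votes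
    have h5 := g3 i hi
    unfold agreeCount
    omega) huniq
  cases hk : keyRowIndex N votes with
  | none =>
    simp only
    rw [PMF.prob_pure, if_neg]
    · exact zero_le
    · refine not_not.2 ⟨fun i w h => by simp at h, fun i h1 h2 => ?_⟩
      have := hspec.2 i ⟨h1, h2⟩
      simp [hk] at this
  | some i =>
    simp only
    refine (PMF.prob_bind_le_add _ _ _ _ 0 fun w hw => ?_).trans
      ((add_zero _).trans_le (hb1 H))
    rw [PMF.prob_pure, if_neg]
    refine not_not.2 ⟨fun j w' h => ?_, fun j h1 h2 => ?_⟩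
    · obtain ⟨rfl, rfl⟩ : i = j ∧ w = w' := by simpa using h
      exact abs_sub_le_of_dominant hη hη1 (hv0 i) (ha H i) (hspec.1 i hk) (not_not.1 hw)
    · have := hspec.2 j ⟨h1, h2⟩
      rw [hk, Option.some_inj] at this
      exact ⟨w, by rw [this]⟩

end Vote

/-! ### Find-Heavy-Rows -/

/-- The total weight that a set of reported rows assigns to row `i`. -/
noncomputable def reportedWeight {n : ℕ} (Q : Finset (Fin n × ℝ)) (i : Fin n) : ℝ :=
  ∑ p ∈ Q, if p.1 = i then p.2 else 0

/-- The conclusions that Find-Heavy-Rows has to satisfy on the rows sampled by `P`: every sampled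
row is reported accurately, or it is light and not reported. -/
def HeavyRowsCorrect {n : ℕ} (u : Fin n → ℝ) (η α : ℝ) (P : Fin n → Bool)
    (Q : Finset (Fin n × ℝ)) : Prop :=
  ∀ i, |(if P i then u i else 0) - reportedWeight Q i| ≤ η * (if P i then u i else 0) ∨
    |(if P i then u i else 0) - reportedWeight Q i| ≤ (if P i then u i else 0) ∧
      (if P i then u i else 0) ≤ α * sampledSum u P

section HeavyRows

variable {n τ : ℕ} {u : Fin n → ℝ} {r η α : ℝ}

/-- Every heavy row dominates its bucket. -/
def Isolates (u : Fin n → ℝ) (r η α : ℝ) (P : Fin n → Bool) (H : Fin n → Fin τ) : Prop :=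
  ∀ i, α * sampledSum u P < (if P i then u i else 0) →
    50 * r ^ 4 / η * (sampledSum u (hadHash P fun j => decide (H j = H i))
      - if P i then u i else 0) ≤ if P i then u i else 0

theorem sampledSum_bucket_sub (P : Fin n → Bool) (H : Fin n → Fin τ) (i : Fin n) :
    sampledSum u (hadHash P fun j => decide (H j = H i)) - (if P i then u i else 0)
      = ∑ j ∈ Finset.univ.erase i,
        (if P j then u j else 0) * (if H j = H i then (1 : ℝ) else 0) := by
  unfold sampledSum
  rw [← Finset.add_sum_erase _ _ (Finset.mem_univ i)]
  simp only [hadHash, decide_true, Bool.and_true, add_sub_cancel_left]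
  refine Finset.sum_congr rfl fun j _ => ?_
  by_cases hP : P j = true <;> by_cases h : H j = H i <;> simp [h, hP]

/-- Markov's inequality for the weight that collides with a heavy row, whose mean is at most
`sampledSum u P / τ`, followed by a union bound over the heavy rows. -/
theorem prob_not_isolates_le {G : HashFamily n (Fin τ)} (hG : G.PairwiseIndependent)
    (hu : ∀ i, 0 ≤ u i) (hη : 0 < η) (hr : 1 ≤ r) (hα : 0 < α) (P : Fin n → Bool) :
    (G.law.prob fun H => ¬ Isolates u r η α P H)
      ≤ ENNReal.ofReal (50 * (r ^ 4 / η) / (τ * α ^ 2)) := by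
  classical
  set v : Fin n → ℝ := fun i => if P i then u i else 0 with hv
  have hv0 : ∀ i, 0 ≤ v i := fun i => by simp only [hv]; split_ifs <;> simp [hu]
  set S := sampledSum u P with hS
  have hSsum : S = ∑ i, v i := rfl
  have hS0 : 0 ≤ S := sampledSum_nonneg hu P
  set κ := 50 * (r ^ 4 / η) / (τ * α ^ 2) with hκ
  have hκ0 : 0 ≤ κ := by positivity
  have h1 : ∀ i, (G.law.prob fun H => α * S < v i ∧
      ¬ 50 * r ^ 4 / η * (sampledSum u (hadHash P fun j => decide (H j = H i)) - v i) ≤ v i)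
      ≤ ENNReal.ofReal (v i / S * κ) := by
    intro i
    by_cases hi : α * S < v i
    · have hvi : 0 < v i := (mul_nonneg hα.le hS0).trans_lt hi
      have hSpos : 0 < S := hvi.trans_le (sampled_le_sampledSum hu P i)
      set Z : (Fin n → Fin τ) → ℝ := fun H => ∑ j ∈ Finset.univ.erase i,
        v j * (if H j = H i then (1 : ℝ) else 0) with hZ
      have hZ0 : ∀ H, 0 ≤ Z H := fun H => Finset.sum_nonneg fun j _ =>
        mul_nonneg (hv0 j) (by split_ifs <;> simp)
      have h2 := PMF.prob_mul_le_expect G.law (fun H => α * S < v i ∧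
          ¬ 50 * r ^ 4 / η * (sampledSum u (hadHash P fun j => decide (H j = H i)) - v i) ≤ v i)
        (fun H => ENNReal.ofReal (50 * r ^ 4 / η / v i * Z H)) 1 fun H h => by
          rw [← ENNReal.ofReal_one]
          refine ENNReal.ofReal_le_ofReal ?_
          have h3 := h.2
          rw [sampledSum_bucket_sub, not_le] at h3
          rw [div_mul_eq_mul_div, le_div_iff₀ hvi, one_mul]
          exact h3.le
      rw [mul_one, HashFamily.law_expect _ _ fun H => mul_nonneg (by positivity) (hZ0 H)] at h2
      refine h2.trans (ENNReal.ofReal_le_ofReal ?_)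
      have h4 : G.mean Z ≤ S / τ := by
        rw [hZ, HashFamily.mean_sum, hSsum, Finset.sum_div]
        refine (Finset.sum_le_sum (g := fun j => v j / τ) fun j hj => ?_).trans
          (Finset.sum_le_sum_of_subset_of_nonneg (Finset.subset_univ _) fun k _ _ =>
            div_nonneg (hv0 k) (Nat.cast_nonneg _))
        rw [HashFamily.mean_const_mul,
          HashFamily.mean_collision hG (Finset.ne_of_mem_erase hj).symm,
          mul_one_div]
      rw [HashFamily.mean_const_mul]
      refine (mul_le_mul_of_nonneg_left h4 (by positivity)).trans ?_
      -- Heaviness is used twice, to make the bound for row `i` proportional to its share `v i / S`.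
      -- The shares sum to at most 1, so the number of heavy rows need not be counted.
      have h5 : S / v i ≤ v i / S / α ^ 2 := by
        rw [div_div, div_le_div_iff₀ hvi (by positivity)]
        nlinarith [mul_nonneg hα.le hS0]
      calc 50 * r ^ 4 / η / v i * (S / τ) = 50 * (r ^ 4 / η) / τ * (S / v i) := by ring
        _ ≤ 50 * (r ^ 4 / η) / τ * (v i / S / α ^ 2) := by gcongr
        _ = v i / S * κ := by rw [hκ]; ring
    · simp [hi, PMF.prob]
  have h6 : (G.law.prob fun H => ¬ Isolates u r η α P H)
      ≤ G.law.prob fun H => ∃ i, α * S < v i ∧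
      ¬ 50 * r ^ 4 / η * (sampledSum u (hadHash P fun j => decide (H j = H i)) - v i) ≤ v i := by
    refine PMF.prob_mono _ fun H h => ?_
    unfold Isolates at h
    push Not at h
    obtain ⟨i, hi, hi'⟩ := h
    exact ⟨i, hi, not_le.2 hi'⟩
  refine h6.trans ((PMF.prob_exists _ _).trans ((Finset.sum_le_sum fun i _ => h1 i).trans ?_))
  rw [← ENNReal.ofReal_sum_of_nonneg fun i _ => mul_nonneg (div_nonneg (hv0 i) hS0) hκ0,
    ← Finset.sum_mul, ← Finset.sum_div, ← hSsum]
  refine ENNReal.ofReal_le_ofReal ?_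
  exact mul_le_of_le_one_left hκ0 (div_self_le_one S)

open Classical in
-- Only the bucket of row `i` can report it with a non-zero weight, so its total reported weight is
-- the answer of that bucket, or zero. A heavy row dominates its bucket and therefore is reported
-- there.
theorem heavyRowsCorrect_of_keyRowCorrect (hu : ∀ i, 0 ≤ u i) (hα : 0 < α) {P : Fin n → Bool}
    {H : Fin n → Fin τ} (hH : Isolates u r η α P H) {C : List (Option (Fin n × ℝ))}
    (hC : List.Forall₂ (fun k o => KeyRowCorrect u r η (hadHash P fun i => decide (H i = k)) o)
      (List.finRange τ) C) :
    HeavyRowsCorrect u η α P C.reduceOption.toFinset := by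
  obtain ⟨hlen, hget⟩ := List.forall₂_iff_get.1 hC
  rw [List.length_finRange] at hlen
  obtain ⟨o, ho, hmem⟩ : ∃ o : Fin τ → Option (Fin n × ℝ),
      (∀ k, KeyRowCorrect u r η (hadHash P fun i => decide (H i = k)) (o k)) ∧
      ∀ p, p ∈ C.reduceOption.toFinset ↔ ∃ k, o k = some p := by
    refine ⟨fun k => C.get (k.cast hlen), fun k => ?_, fun p => ?_⟩
    · simpa using hget k (by simp) (hlen ▸ k.2)
    · rw [List.mem_toFinset, List.reduceOption_mem_iff, List.mem_iff_get]
      constructor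
      · rintro ⟨m, hm⟩
        exact ⟨m.cast hlen.symm, by simpa using hm⟩
      · rintro ⟨k, hk⟩
        exact ⟨k.cast hlen, hk⟩
  -- Outside its own bucket a row has sampled weight zero, and relative accuracy at zero means
  -- equality.
  have hzero : ∀ i w k, o k = some (i, w) → k ≠ H i → w = 0 := fun i w k hk hne => by
    have h := (ho k).1 i w hk
    simpa [hadHash, hne.symm] using h
  intro i
  have hv0 : 0 ≤ if P i then u i else 0 := by split_ifs <;> simp [hu]
  by_cases hi : ∃ w, o (H i) = some (i, w)
  · obtain ⟨w, hw⟩ := hi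
    left
    have hc : reportedWeight C.reduceOption.toFinset i = w := by
      unfold reportedWeight
      rw [Finset.sum_eq_single_of_mem (i, w) ((hmem _).2 ⟨_, hw⟩)]
      · simp
      · rintro ⟨j, w'⟩ hp hne
        obtain ⟨k, hk⟩ := (hmem _).1 hp
        by_cases hj : j = i
        · subst hj
          by_cases hkH : k = H j
          · subst hkH
            rw [hw] at hk
            exact absurd (Option.some_inj.1 hk).symm hne
          · simp [hzero _ _ _ hk hkH]
        · simp [hj]
    rw [hc, abs_sub_comm]
    simpa [hadHash] using (ho (H i)).1 i w hw
  · right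
    have hc : reportedWeight C.reduceOption.toFinset i = 0 := by
      unfold reportedWeight
      refine Finset.sum_eq_zero ?_
      rintro ⟨j, w'⟩ hp
      obtain ⟨k, hk⟩ := (hmem _).1 hp
      by_cases hj : j = i
      · subst hj
        have hkH : k ≠ H j := fun h => hi ⟨w', h ▸ hk⟩
        simp [hzero _ _ _ hk hkH]
      · simp [hj]
    rw [hc, sub_zero, abs_of_nonneg hv0]
    refine ⟨le_rfl, ?_⟩
    by_contra hlt
    rw [not_le] at hlt
    refine hi ((ho (H i)).2 i ?_ ?_)
    · simpa [hadHash] using (mul_nonneg hα.le (sampledSum_nonneg hu P)).trans_lt hlt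
    · simpa [hadHash] using hH i hlt

theorem heavyRowsLaw_prob_le {F : HashFamily n Bool} {G : HashFamily n (Fin τ)}
    {b1 b2 : (Fin n → Bool) → PMF ℝ} {a : (Fin n → Bool) → ℝ} {d : ℝ≥0∞}
    (hF : F.PairwiseIndependent) (hG : G.PairwiseIndependent) (hu : ∀ i, 0 ≤ u i) (hr : 1 ≤ r)
    (hη : 0 < η) (hη1 : η ≤ 1) (hα : 0 < α)
    (ha : ∀ (H : Fin n → Bool) i,
      |a H - if H i then u i else 0| ≤ sampledSum u H - if H i then u i else 0)
    (hb1 : ∀ H, ((b1 H).prob fun y => ¬ IsRelApprox (η / 2) y (a H)) ≤ d)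
    (hb2 : ∀ H, ((b2 H).prob fun y => ¬ IsFactorApprox r y (sampledSum u H))
      ≤ ENNReal.ofReal (1 / 100))
    {N : ℕ} (hN : 0 < N) (P : Fin n → Bool) :
    ((heavyRowsLaw F G b1 b2 (50 * r ^ 2 / η) N P).prob fun Q => ¬ HeavyRowsCorrect u η α P Q)
      ≤ ENNReal.ofReal (50 * (r ^ 4 / η) / (τ * α ^ 2))
        + τ * (ENNReal.ofReal (2 * n * (24 / 25) ^ N) + d) := by
  classical
  refine (PMF.prob_bind_le_add _ _ (fun H => ¬ Isolates u r η α P H) _ _ fun H hH => ?_).trans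
    (add_le_add (prob_not_isolates_le hG hu hη hr hα P) le_rfl)
  have h := PMF.prob_not_forall₂_mapM
    (fun k => keyRowLaw F b1 b2 (50 * r ^ 2 / η) N (hadHash P fun i => decide (H i = k)))
    (fun k o => KeyRowCorrect u r η (hadHash P fun i => decide (H i = k)) o)
    (fun k => keyRowLaw_prob_le hF hu hr hη hη1 ha hb1 hb2 hN _) (List.finRange τ)
  rw [List.length_finRange] at h
  refine (PMF.prob_bind_le_add _ _ _ _ 0 fun C hC => ?_).trans ((add_zero _).trans_le h)
  rw [PMF.prob_pure, if_neg]
  refine not_not.2 ?_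
  convert heavyRowsCorrect_of_keyRowCorrect hu hα (not_not.1 hH) (not_not.1 hC)

end HeavyRows

/-! ### The levels of Recursive Sum, drawn one after the other -/

section Levels

variable {n : ℕ} (F : HashFamily n Bool) (q : (Fin n → Bool) → PMF (Finset (Fin n × ℝ)))

/-- The joint law of `m` hash functions and heavy-row sets, where each heavy-row set is drawn just
before the hash function of the next level; `P` is the product of the previous hash functions. -/
noncomputable def interleavedLaw :
    ℕ → (Fin n → Bool) → PMF (List (Fin n → Bool) × List (Finset (Fin n × ℝ)))
  | 0, _ => PMF.pure ([], [])
  | m + 1, P => (q P).bind fun Q => F.law.bind fun h =>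
      (interleavedLaw m (hadHash P h)).bind fun x => PMF.pure (h :: x.1, Q :: x.2)

theorem hadHash_prefixHash_zero (P : Fin n → Bool) (hs : List (Fin n → Bool)) :
    hadHash P (prefixHash hs 0) = P := by
  funext i
  simp [hadHash, prefixHash]

theorem hadHash_prefixHash_succ (P h : Fin n → Bool) (hs : List (Fin n → Bool)) (j : ℕ) :
    hadHash P (prefixHash (h :: hs) (j + 1)) = hadHash (hadHash P h) (prefixHash hs j) := by
  funext i
  simp [hadHash, prefixHash, Bool.and_assoc]

theorem mapM_range_succ {β : Type} (f : ℕ → PMF β) (m : ℕ) :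
    ((List.range (m + 1)).mapM f : PMF (List β))
      = (f 0).bind fun y => PMF.bind ((List.range m).mapM fun j => f (j + 1))
          fun ys => PMF.pure (y :: ys) := by
  rw [List.range_succ_eq_map, PMF.mapM_cons_eq, List.mapM_map]
  rfl

/-- The heavy-row set of a level depends only on earlier hash functions, so independent draws may be
exchanged. In the new order each hash function is fresh with respect to the reports whose signs it
provides. -/
theorem bind_mapM_eq_interleavedLaw (m : ℕ) (P : Fin n → Bool) :
    (PMF.bind ((List.range m).mapM fun _ => F.law) fun hs =>
      PMF.bind ((List.range m).mapM fun j => q (hadHash P (prefixHash hs j))) fun Qs =>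
        PMF.pure (hs, Qs)) = interleavedLaw F q m P := by
  induction m generalizing P with
  | zero =>
    change PMF.bind (PMF.pure []) (fun hs => PMF.bind (PMF.pure []) fun Qs => _) = _
    simp [interleavedLaw]
  | succ m ih =>
    rw [mapM_range_succ]
    simp only [mapM_range_succ, PMF.bind_bind, PMF.pure_bind, hadHash_prefixHash_zero,
      hadHash_prefixHash_succ]
    have h1 : ∀ h : Fin n → Bool,
        (PMF.bind ((List.range m).mapM fun _ => F.law) fun hs => (q P).bind fun Q =>
          PMF.bind ((List.range m).mapM fun j => q (hadHash (hadHash P h) (prefixHash hs j)))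
            fun Qs => PMF.pure (h :: hs, Q :: Qs))
        = (q P).bind fun Q => (interleavedLaw F q m (hadHash P h)).bind
            fun x => PMF.pure (h :: x.1, Q :: x.2) := by
      intro h
      rw [PMF.bind_comm]
      congr 1
      funext Q
      rw [← ih (hadHash P h)]
      simp only [PMF.bind_bind, PMF.pure_bind]
    simp only [h1]
    rw [PMF.bind_comm]
    rfl

theorem levelsLaw_eq_interleavedLaw (φ : ℕ) :
    levelsLaw F q φ = interleavedLaw F q φ fun _ => true := by
  rw [← bind_mapM_eq_interleavedLaw]
  unfold levelsLaw
  have h1 : ∀ H : Fin n → Bool, hadHash (fun _ => true) H = H := fun H => by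
    funext i
    simp [hadHash]
  simp only [h1]

theorem combineLevels_cons (h : Fin n → Bool) (hs : List (Fin n → Bool))
    (Q : Finset (Fin n × ℝ)) (Qs : List (Finset (Fin n × ℝ))) (Y : ℝ) :
    combineLevels (h :: hs) (Q :: Qs) Y = 2 * combineLevels hs Qs Y
      + ∑ i, (1 - 2 * (if h i then (1 : ℝ) else 0)) * reportedWeight Q i := by
  have h1 : ∑ i, (1 - 2 * (if h i then (1 : ℝ) else 0)) * reportedWeight Q i
      = ∑ p ∈ Q, (1 - 2 * (if h p.1 then (1 : ℝ) else 0)) * p.2 := by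
    simp only [reportedWeight, Finset.mul_sum]
    rw [Finset.sum_comm]
    refine Finset.sum_congr rfl fun p _ => ?_
    simp only [mul_ite, mul_zero]
    rw [Finset.sum_ite_eq]
    simp
  rw [h1]
  rfl

theorem two_mul_sampledSum_hadHash (u : Fin n → ℝ) (P h : Fin n → Bool) :
    2 * sampledSum u (hadHash P h) = sampledSum u P
      - ∑ i, (1 - 2 * (if h i then (1 : ℝ) else 0)) * (if P i then u i else 0) := by
  unfold sampledSum
  rw [Finset.mul_sum, ← Finset.sum_sub_distrib]
  refine Finset.sum_congr rfl fun i _ => ?_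
  cases hP : P i <;> cases hh : h i <;> simp [hadHash, hP, hh]
  ring

end Levels

/-! ### The potential that controls the error of Recursive Sum -/

/-- The potential of a row whose weight, relative to the expected weight of its level, is `x`. -/
noncomputable def rowPotential (x : ℝ) : ℝ :=
  if x ≤ 40 then 33 / 1000 * x - x ^ 2 / 10000 else 1

theorem rowPotential_nonneg {x : ℝ} (hx : 0 ≤ x) : 0 ≤ rowPotential x := by
  unfold rowPotential
  split_ifs <;> nlinarith

theorem rowPotential_le (x : ℝ) : rowPotential x ≤ 33 / 1000 * x := by
  unfold rowPotential
  split_ifs <;> nlinarith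

/-- A row survives with probability 1/2 and its relative weight then doubles. For `x ≤ 20` the
quadratic term makes this an equality; for `20 < x ≤ 40` the doubled row has potential 1, and the
slope 33/1000 leaves enough room. -/
theorem rowPotential_step {x : ℝ} (hx40 : x ≤ 40) :
    x ^ 2 / 10000 + rowPotential (2 * x) / 2 ≤ rowPotential x := by
  unfold rowPotential
  split_ifs <;> nlinarith

/-- The potential of a row when `m` of `φ` levels remain. -/
noncomputable def levelPotential (φ m : ℕ) (x : ℝ) : ℝ :=
  rowPotential x + m * ((1 / (250 * φ ^ 2) + 1 / (40 * φ)) * x) + (1 / 2) ^ m / 10 ^ 10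

theorem levelPotential_nonneg (φ m : ℕ) {x : ℝ} (hx : 0 ≤ x) : 0 ≤ levelPotential φ m x := by
  have := rowPotential_nonneg hx
  unfold levelPotential
  positivity

/-- The linear terms are preserved by halving and doubling, so dropping one level frees their
coefficient once. The part `1 / (250 * φ ^ 2)` pays for light rows; the part `1 / (40 * φ)` is kept
for levels of excessive total weight. The last term is the expected number of final survivors,
divided by 10¹⁰. -/
theorem levelPotential_step (φ m : ℕ) {x : ℝ} (hx : 0 ≤ x) (hx40 : x ≤ 40) :
    x ^ 2 / 10000 + x / (250 * φ ^ 2) + levelPotential φ m (2 * x) / 2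
      ≤ levelPotential φ (m + 1) x := by
  have h1 := rowPotential_step hx40
  unfold levelPotential
  have h2 : 0 ≤ 1 / (40 * (φ : ℝ)) * x := by positivity
  have h3 : x / (250 * (φ : ℝ) ^ 2) = 1 / (250 * (φ : ℝ) ^ 2) * x := by ring
  rw [h3, pow_succ (1 / 2 : ℝ)]
  push_cast
  linarith

/-- The failure event of Recursive Sum with `m` remaining levels, started from the hash function
`P` with an accumulated error `M` and the scale `s`. -/
def LevelsFail {n : ℕ} (u : Fin n → ℝ) (m : ℕ) (t : ℝ) (P : Fin n → Bool) (M s : ℝ)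
    (x : List (Fin n → Bool) × List (Finset (Fin n × ℝ))) : Prop :=
  t < |M + s * (combineLevels x.1 x.2 (sampledSum u (hadHash P (prefixHash x.1 m)))
      - sampledSum u P)| ∨
    10 ^ 10 < (Finset.univ.filter fun i => hadHash P (prefixHash x.1 m) i = true ∧ u i ≠ 0).card

/-- By `two_mul_sampledSum_hadHash` the error of a level is its own signed reporting error plus
twice the error of the next level. -/
theorem levelsFail_cons {n : ℕ} (u : Fin n → ℝ) (m : ℕ) (t : ℝ) (P : Fin n → Bool) (M s : ℝ)
    (h : Fin n → Bool) (Q : Finset (Fin n × ℝ))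
    (x : List (Fin n → Bool) × List (Finset (Fin n × ℝ))) :
    LevelsFail u (m + 1) t P M s (h :: x.1, Q :: x.2) ↔
      LevelsFail u m t (hadHash P h)
        (M + ∑ i, (1 - 2 * (if h i then (1 : ℝ) else 0)) *
          (s * (reportedWeight Q i - if P i then u i else 0))) (2 * s) x := by
  unfold LevelsFail
  simp only [hadHash_prefixHash_succ, combineLevels_cons]
  have h1 : ∑ i, (1 - 2 * (if h i then (1 : ℝ) else 0)) *
        (s * (reportedWeight Q i - if P i then u i else 0))
      = s * (∑ i, (1 - 2 * (if h i then (1 : ℝ) else 0)) * reportedWeight Q i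
        - ∑ i, (1 - 2 * (if h i then (1 : ℝ) else 0)) * (if P i then u i else 0)) := by
    rw [← Finset.sum_sub_distrib, Finset.mul_sum]
    exact Finset.sum_congr rfl fun i _ => by ring
  have h2 := two_mul_sampledSum_hadHash u P h
  rw [h1]
  have h3 : ∀ c : ℝ, M + s * (2 * c + ∑ i, (1 - 2 * (if h i then (1 : ℝ) else 0))
        * reportedWeight Q i - sampledSum u P)
      = M + s * (∑ i, (1 - 2 * (if h i then (1 : ℝ) else 0)) * reportedWeight Q i
        - ∑ i, (1 - 2 * (if h i then (1 : ℝ) else 0)) * (if P i then u i else 0))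
        + 2 * s * (c - sampledSum u (hadHash P h)) := fun c => by
    have : sampledSum u P = 2 * sampledSum u (hadHash P h)
      + ∑ i, (1 - 2 * (if h i then (1 : ℝ) else 0)) * (if P i then u i else 0) := by linarith
    rw [this]
    ring
  rw [h3]

section Core

variable {n : ℕ} {u : Fin n → ℝ} {X ε : ℝ} {φ : ℕ}

/-- The squared error made at one level is controlled by the weights of the sampled rows. -/
theorem sq_levelError_le (hu : ∀ i, 0 ≤ u i) (hX : 0 < X) (hε : 0 < ε) (hφ : 0 < φ)
    {P : Fin n → Bool} {Q : Finset (Fin n × ℝ)} {s : ℝ} (hs : 0 < s)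
    (hQ : HeavyRowsCorrect u (1 / 100 * ε) (heavyParam (1 / 100 * ε) φ) P Q)
    (hP : s * sampledSum u P ≤ 40 * φ * X) (i : Fin n) :
    (s * (reportedWeight Q i - if P i then u i else 0)) ^ 2 / (ε * X) ^ 2
      ≤ if P i then (s * u i / X) ^ 2 / 10000 + s * u i / X / (250 * φ ^ 2) else 0 := by
  have hφ' : (0 : ℝ) < φ := by exact_mod_cast hφ
  rw [div_le_iff₀ (by positivity), mul_pow]
  have hi := hQ i
  rw [abs_sub_comm] at hi
  by_cases hPi : P i = true
  · simp only [hPi, if_true] at hi ⊢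
    set z := reportedWeight Q i - u i
    have hz : z ^ 2 = |z| ^ 2 := (sq_abs z).symm
    have e1 : ((s * u i / X) ^ 2 / 10000 + s * u i / X / (250 * (φ : ℝ) ^ 2)) * (ε * X) ^ 2
        = s ^ 2 * (1 / 100 * ε * u i) ^ 2 + s * u i * (ε ^ 2 / (250 * (φ : ℝ) ^ 2) * X) := by
      field_simp
      ring
    have p1 : 0 ≤ s ^ 2 * (1 / 100 * ε * u i) ^ 2 := by positivity
    have p2 : 0 ≤ s * u i * (ε ^ 2 / (250 * (φ : ℝ) ^ 2) * X) :=
      mul_nonneg (mul_nonneg hs.le (hu i)) (by positivity)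
    rw [e1, hz]
    rcases hi with h | ⟨h, h'⟩
    · have := mul_le_mul_of_nonneg_left (pow_le_pow_left₀ (abs_nonneg z) h 2) (sq_nonneg s)
      linarith
    · have e2 : heavyParam (1 / 100 * ε) φ * (40 * φ * X)
          = ε ^ 2 / (250 * (φ : ℝ) ^ 2) * X := by
        unfold heavyParam
        field_simp
        ring
      have hα : 0 ≤ heavyParam (1 / 100 * ε) φ := by unfold heavyParam; positivity
      have e3 : s * u i ≤ ε ^ 2 / (250 * (φ : ℝ) ^ 2) * X := by
        rw [← e2]
        calc s * u i ≤ s * (heavyParam (1 / 100 * ε) φ * sampledSum u P) := by gcongr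
          _ = heavyParam (1 / 100 * ε) φ * (s * sampledSum u P) := by ring
          _ ≤ _ := by gcongr
      have e4 : s ^ 2 * |z| ^ 2 ≤ s * u i * (s * u i) := by
        have := mul_le_mul_of_nonneg_left (pow_le_pow_left₀ (abs_nonneg z) h 2) (sq_nonneg s)
        linarith
      have e5 := mul_le_mul_of_nonneg_left e3 (mul_nonneg hs.le (hu i))
      linarith
  · simp only [hPi, if_false, Bool.false_eq_true, mul_zero, sub_zero] at hi ⊢
    have h0 : reportedWeight Q i = 0 := by
      rcases hi with h | ⟨h, -⟩ <;> exact abs_nonpos_iff.1 h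
    simp [h0]

/-- The stopping rule: in these cases the claimed probability bound is trivial. An overweight level
is covered by the linear terms of a single level, an overweight row by its own potential 1. -/
theorem one_le_sum_levelPotential (hu : ∀ i, 0 ≤ u i) (hX : 0 < X) (hφ : 0 < φ) {m : ℕ}
    {P : Fin n → Bool} {s : ℝ} (hs : 0 < s)
    (h : 40 * φ * X < s * sampledSum u P ∨ ∃ i, P i = true ∧ 40 < s * u i / X) :
    1 ≤ ∑ i, if P i then levelPotential φ (m + 1) (s * u i / X) else 0 := by
  have hφ' : (0 : ℝ) < φ := by exact_mod_cast hφ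
  have hx : ∀ i, 0 ≤ s * u i / X := fun i => div_nonneg (mul_nonneg hs.le (hu i)) hX.le
  rcases h with h | ⟨i, hi, h⟩
  · have h1 : ∀ i, 1 / (40 * φ * X) * (s * if P i then u i else 0)
        ≤ if P i then levelPotential φ (m + 1) (s * u i / X) else 0 := by
      intro i
      split_ifs
      · have h2 := rowPotential_nonneg (hx i)
        have h3 : 0 ≤ 1 / (250 * (φ : ℝ) ^ 2) * (s * u i / X) :=
          mul_nonneg (by positivity) (hx i)
        have h4 : 0 ≤ (m : ℝ) * ((1 / (250 * (φ : ℝ) ^ 2) + 1 / (40 * φ)) * (s * u i / X)) :=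
          mul_nonneg (Nat.cast_nonneg _) (mul_nonneg (by positivity) (hx i))
        have h5 : 1 / (40 * φ * X) * (s * u i) = 1 / (40 * (φ : ℝ)) * (s * u i / X) := by
          field_simp
        have h6 : (0 : ℝ) ≤ (1 / 2) ^ (m + 1) / 10 ^ 10 := by positivity
        unfold levelPotential
        push_cast
        rw [h5]
        linarith
      · simp
    refine le_trans ?_ (Finset.sum_le_sum fun i _ => h1 i)
    rw [← Finset.mul_sum, ← Finset.mul_sum, one_div, inv_mul_eq_div, le_div_iff₀ (by positivity),
      one_mul]
    exact h.le
  · refine le_trans ?_ (Finset.single_le_sum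
      (f := fun i => if P i then levelPotential φ (m + 1) (s * u i / X) else 0) (fun i _ => ?_)
      (Finset.mem_univ i))
    · simp only [hi, if_true]
      unfold levelPotential rowPotential
      rw [if_neg (not_le.2 h)]
      have h4 : 0 ≤ ((m + 1 : ℕ) : ℝ)
          * ((1 / (250 * (φ : ℝ) ^ 2) + 1 / (40 * φ)) * (s * u i / X)) :=
        mul_nonneg (Nat.cast_nonneg _) (mul_nonneg (by positivity) (hx i))
      have h6 : (0 : ℝ) ≤ (1 / 2) ^ (m + 1) / 10 ^ 10 := by positivity
      linarith
    · split_ifs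
      · exact levelPotential_nonneg φ _ (hx i)
      · exact le_rfl

theorem levelsFail_zero_le (hu : ∀ i, 0 ≤ u i) (hX : 0 < X) (hε : 0 < ε) {P : Fin n → Bool}
    {M s : ℝ} (hs : 0 < s) (h : LevelsFail u 0 (ε * X) P M s ([], [])) :
    1 ≤ M ^ 2 / (ε * X) ^ 2 + ∑ i, if P i then levelPotential φ 0 (s * u i / X) else 0 := by
  have hx : ∀ i, 0 ≤ s * u i / X := fun i => div_nonneg (mul_nonneg hs.le (hu i)) hX.le
  have h0 : ∀ i, 1 / 10 ^ 10 * (if P i = true ∧ u i ≠ 0 then (1 : ℝ) else 0)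
      ≤ if P i then levelPotential φ 0 (s * u i / X) else 0 := fun i => by
    have h1 := rowPotential_nonneg (hx i)
    have h2 : 1 / 10 ^ 10 ≤ levelPotential φ 0 (s * u i / X) := by
      unfold levelPotential
      simpa using h1
    by_cases hP : P i = true
    · simp only [hP, true_and, if_true]
      refine le_trans ?_ h2
      split_ifs <;> norm_num
    · simp [hP]
  have h3 := Finset.sum_le_sum fun i (_ : i ∈ Finset.univ) => h0 i
  rw [← Finset.mul_sum, Finset.sum_boole] at h3
  unfold LevelsFail at h
  simp only [hadHash_prefixHash_zero] at h
  rcases h with h | h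
  · have h4 : 1 ≤ M ^ 2 / (ε * X) ^ 2 := by
      rw [one_le_div (by positivity), ← sq_abs M]
      refine pow_le_pow_left₀ (by positivity) ?_ 2
      have : combineLevels ([] : List (Fin n → Bool)) [] (sampledSum u P) = sampledSum u P := rfl
      simp only [this, sub_self, mul_zero, add_zero] at h
      exact h.le
    have h5 : (0 : ℝ) ≤ 1 / 10 ^ 10
      * ((Finset.univ.filter fun i => P i = true ∧ u i ≠ 0).card : ℝ) := by positivity
    linarith
  · have h5 : (10 ^ 10 : ℝ) ≤ ((Finset.univ.filter fun i => P i = true ∧ u i ≠ 0).card : ℝ) := by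
      exact_mod_cast h.le
    have h6 : 0 ≤ M ^ 2 / (ε * X) ^ 2 := by positivity
    have h7 : (1 : ℝ) ≤ 1 / 10 ^ 10
      * ((Finset.univ.filter fun i => P i = true ∧ u i ≠ 0).card : ℝ) := by
      rw [one_div, inv_mul_eq_div, one_le_div (by positivity)]
      exact h5
    linarith

/-- The supermartingale step. Random signs remove the cross terms from the squared error, and each
row's increment is paid for by the drop of its potential. -/
theorem mean_potential_le {F : HashFamily n Bool} (hF : F.PairwiseIndependent)
    (hu : ∀ i, 0 ≤ u i) (hX : 0 < X) (hε : 0 < ε) (hφ : 0 < φ) {m : ℕ}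
    {P : Fin n → Bool} {Q : Finset (Fin n × ℝ)} {M s : ℝ} (hs : 0 < s)
    (hQ : HeavyRowsCorrect u (1 / 100 * ε) (heavyParam (1 / 100 * ε) φ) P Q)
    (hP : s * sampledSum u P ≤ 40 * φ * X) (hPi : ∀ i, P i = true → s * u i / X ≤ 40) :
    (F.mean fun h => (M + ∑ i, (1 - 2 * (if h i then (1 : ℝ) else 0)) *
          (s * (reportedWeight Q i - if P i then u i else 0))) ^ 2 / (ε * X) ^ 2
        + ∑ i, if hadHash P h i then levelPotential φ m (2 * s * u i / X) else 0)
      ≤ M ^ 2 / (ε * X) ^ 2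
        + ∑ i, if P i then levelPotential φ (m + 1) (s * u i / X) else 0 := by
  have hx : ∀ i, 0 ≤ s * u i / X := fun i => div_nonneg (mul_nonneg hs.le (hu i)) hX.le
  rw [HashFamily.mean_add, HashFamily.mean_sum]
  have h1 : (F.mean fun h => (M + ∑ i, (1 - 2 * (if h i then (1 : ℝ) else 0)) *
          (s * (reportedWeight Q i - if P i then u i else 0))) ^ 2 / (ε * X) ^ 2)
      = M ^ 2 / (ε * X) ^ 2 +
        ∑ i, (s * (reportedWeight Q i - if P i then u i else 0)) ^ 2 / (ε * X) ^ 2 := by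
    simp only [div_eq_inv_mul _ ((ε * X) ^ 2)]
    rw [HashFamily.mean_const_mul, HashFamily.mean_sq_signedSum hF, mul_add, Finset.mul_sum]
  rw [h1, add_assoc, ← Finset.sum_add_distrib]
  gcongr with i
  have h2 : (F.mean fun h => if hadHash P h i then levelPotential φ m (2 * s * u i / X) else 0)
      = if P i then levelPotential φ m (2 * (s * u i / X)) / 2 else 0 := by
    split_ifs with hPi'
    · simp only [hadHash, hPi', Bool.true_and]
      rw [HashFamily.mean_apply hF i
        fun b => if b = true then levelPotential φ m (2 * s * u i / X) else 0]
      simp only [Fintype.sum_bool, Fintype.card_bool, if_true, Bool.false_eq_true, if_false,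
        add_zero, Nat.cast_ofNat]
      congr 2
      ring
    · simp [hadHash, hPi', HashFamily.mean_const]
  rw [h2]
  refine (add_le_add (sq_levelError_le hu hX hε hφ hs hQ hP i) le_rfl).trans ?_
  split_ifs with hPi'
  · exact levelPotential_step φ m (hx i) (hPi i hPi')
  · simp

/-- Induction on the remaining levels: stop with the trivial bound when a weight is excessive,
otherwise average the induction hypothesis over the fresh hash function. Each level adds one failure
probability `a` for its heavy-row set. -/
theorem interleavedLaw_prob_le {F : HashFamily n Bool}
    {q : (Fin n → Bool) → PMF (Finset (Fin n × ℝ))} {a : ℝ≥0∞} (hF : F.PairwiseIndependent)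
    (hu : ∀ i, 0 ≤ u i) (hX : 0 < X) (hε : 0 < ε) (hφ : 0 < φ)
    (hq : ∀ P, ((q P).prob fun Q =>
      ¬ HeavyRowsCorrect u (1 / 100 * ε) (heavyParam (1 / 100 * ε) φ) P Q) ≤ a)
    (m : ℕ) (P : Fin n → Bool) (M s : ℝ) (hs : 0 < s) :
    (interleavedLaw F q m P).prob (LevelsFail u m (ε * X) P M s)
      ≤ ENNReal.ofReal (M ^ 2 / (ε * X) ^ 2
          + ∑ i, if P i then levelPotential φ m (s * u i / X) else 0) + m * a := by
  classical
  induction m generalizing P M s with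
  | zero =>
    unfold interleavedLaw
    rw [PMF.prob_pure]
    split_ifs with h
    · refine le_trans ?_ le_self_add
      rw [← ENNReal.ofReal_one]
      exact ENNReal.ofReal_le_ofReal (levelsFail_zero_le hu hX hε hs h)
    · exact zero_le
  | succ m ih =>
    by_cases htriv : 40 * φ * X < s * sampledSum u P ∨ ∃ i, P i = true ∧ 40 < s * u i / X
    · refine (PMF.prob_le_one _ _).trans (le_trans ?_ le_self_add)
      rw [← ENNReal.ofReal_one]
      refine ENNReal.ofReal_le_ofReal ?_
      have h1 := one_le_sum_levelPotential hu hX hφ (m := m) hs htriv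
      have h2 : 0 ≤ M ^ 2 / (ε * X) ^ 2 := by positivity
      linarith
    · push Not at htriv
      obtain ⟨hP, hPi⟩ := htriv
      unfold interleavedLaw
      refine (PMF.prob_bind_le_add _ _ _ _ (ENNReal.ofReal (M ^ 2 / (ε * X) ^ 2
          + ∑ i, if P i then levelPotential φ (m + 1) (s * u i / X) else 0) + m * a)
        fun Q hQ => ?_).trans ((add_le_add (hq P) le_rfl).trans_eq ?_)
      · rw [PMF.prob_bind]
        have hstep : ∀ h : Fin n → Bool, ((interleavedLaw F q m (hadHash P h)).bind fun x =>
              PMF.pure (h :: x.1, Q :: x.2)).prob (LevelsFail u (m + 1) (ε * X) P M s)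
            ≤ ENNReal.ofReal ((M + ∑ i, (1 - 2 * (if h i then (1 : ℝ) else 0)) *
                (s * (reportedWeight Q i - if P i then u i else 0))) ^ 2 / (ε * X) ^ 2
              + ∑ i, if hadHash P h i then levelPotential φ m (2 * s * u i / X) else 0)
              + m * a := by
          intro h
          change ((interleavedLaw F q m (hadHash P h)).map fun x => (h :: x.1, Q :: x.2)).prob _ ≤ _
          rw [PMF.prob_map]
          simp only [levelsFail_cons]
          exact ih _ _ _ (by positivity)
        refine (PMF.expect_mono _ hstep).trans ?_
        rw [PMF.expect_add, PMF.expect_const, HashFamily.law_expect]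
        · gcongr
          exact mean_potential_le hF hu hX hε hφ hs (not_not.1 hQ) hP hPi
        · intro h
          refine add_nonneg (by positivity) (Finset.sum_nonneg fun i _ => ?_)
          split_ifs
          · exact levelPotential_nonneg _ _
              (div_nonneg (mul_nonneg (by positivity) (hu i)) hX.le)
          · exact le_rfl
      · push_cast
        ring

/-- On the zero vector, Recursive Sum is exact as long as all heavy-row sets are correct. -/
theorem interleavedLaw_prob_zero_le {F : HashFamily n Bool}
    {q : (Fin n → Bool) → PMF (Finset (Fin n × ℝ))} {a : ℝ≥0∞} {η α : ℝ} (hu : ∀ i, u i = 0)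
    (hq : ∀ P, ((q P).prob fun Q => ¬ HeavyRowsCorrect u η α P Q) ≤ a)
    (m : ℕ) (P : Fin n → Bool) :
    ((interleavedLaw F q m P).prob fun x => combineLevels x.1 x.2 0 ≠ 0) ≤ m * a := by
  classical
  induction m generalizing P with
  | zero =>
    unfold interleavedLaw
    rw [PMF.prob_pure, if_neg]
    · exact zero_le
    · exact not_not.2 rfl
  | succ m ih =>
    unfold interleavedLaw
    refine (PMF.prob_bind_le_add _ _ _ _ (m * a) fun Q hQ => ?_).trans
      ((add_le_add (hq P) le_rfl).trans_eq ?_)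
    · have hQ0 : ∀ i, reportedWeight Q i = 0 := fun i => by
        have h := not_not.1 hQ i
        simp only [hu i, ite_self, mul_zero, zero_sub, abs_neg] at h
        rcases h with h | ⟨h, -⟩ <;> exact abs_nonpos_iff.1 h
      rw [PMF.prob_bind]
      refine (PMF.expect_mono _ (g := fun _ => m * a) fun h => ?_).trans
        (PMF.expect_const _ _).le
      change ((interleavedLaw F q m (hadHash P h)).map fun x => (h :: x.1, Q :: x.2)).prob _ ≤ _
      rw [PMF.prob_map]
      simp only [combineLevels_cons, hQ0, mul_zero, Finset.sum_const_zero, add_zero, ne_eq,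
        mul_eq_zero, OfNat.ofNat_ne_zero, false_or]
      exact ih _
    · push_cast
      ring

end Core

/-! ### The failure probability of Recursive Sum -/

section Failure

variable {n φ : ℕ} {g : ℝ → ℝ} {ε : ℝ}

theorem recursiveSumValue_eq (hg : IsHadamardFunction g) (A : Matrix (Fin n) (Fin n) ℝ)
    (hs : List (Fin n → Bool)) (Qs : List (Finset (Fin n × ℝ))) :
    recursiveSumValue g A φ hs Qs =
      if 10 ^ 10 < (Finset.univ.filter fun i =>
        prefixHash hs φ i = true ∧ rowWeight g A i ≠ 0).card then 0
      else combineLevels hs Qs (sampledSum (rowWeight g A) (prefixHash hs φ)) := by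
  have h1 : ∀ i, rowWeight g (samplingIdentity (prefixHash hs φ) * A) i ≠ 0 ↔
      prefixHash hs φ i = true ∧ rowWeight g A i ≠ 0 := fun i => by
    rw [rowWeight_samplingIdentity hg]
    simp
  unfold recursiveSumValue
  simp only [h1]
  simp only [rowWeight_samplingIdentity hg]
  congr

theorem hadHash_true (H : Fin n → Bool) : hadHash (fun _ => true) H = H := by
  funext i
  simp [hadHash]

theorem levelsFail_of_not_isRelApprox (hg : IsHadamardFunction g)
    (A : Matrix (Fin n) (Fin n) ℝ) (x : List (Fin n → Bool) × List (Finset (Fin n × ℝ)))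
    (h : ¬ IsRelApprox ε (recursiveSumValue g A φ x.1 x.2) (hadamardNorm g A)) :
    LevelsFail (rowWeight g A) φ (ε * hadamardNorm g A) (fun _ => true) 0 1 x := by
  unfold LevelsFail
  rw [hadHash_true]
  by_contra hcon
  rw [not_or, not_lt] at hcon
  rw [recursiveSumValue_eq hg, if_neg hcon.2] at h
  have h1 := hcon.1
  have h2 : sampledSum (rowWeight g A) (fun _ => true) = hadamardNorm g A := by
    simp [sampledSum, hadamardNorm, rowWeight]
  rw [zero_add, one_mul, h2, abs_le] at h1
  exact h ⟨by linarith, by linarith⟩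

theorem sum_levelPotential_le {u : Fin n → ℝ} (hX : 0 < ∑ i, u i)
    (hφ : 0 < φ) (hn : (n : ℝ) ≤ 2 ^ φ) :
    ∑ i, levelPotential φ φ (u i / ∑ i, u i) ≤ 1 / 10 := by
  have hφ' : (1 : ℝ) ≤ φ := by exact_mod_cast hφ
  set X := ∑ i, u i with hXdef
  have hsum : ∑ i, u i / X = 1 := by
    rw [← Finset.sum_div, ← hXdef, div_self hX.ne']
  have h1 : ∀ i, levelPotential φ φ (u i / X)
      ≤ (33 / 1000 + φ * (1 / (250 * φ ^ 2) + 1 / (40 * φ))) * (u i / X)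
        + (1 / 2) ^ φ / 10 ^ 10 := fun i => by
    have := rowPotential_le (u i / X)
    unfold levelPotential
    linarith
  refine (Finset.sum_le_sum fun i _ => h1 i).trans ?_
  rw [Finset.sum_add_distrib, ← Finset.mul_sum, hsum, Finset.sum_const, Finset.card_univ,
    Fintype.card_fin, nsmul_eq_mul]
  have h2 : (φ : ℝ) * (1 / (250 * φ ^ 2) + 1 / (40 * φ)) ≤ 1 / 250 + 1 / 40 := by
    have : (φ : ℝ) * (1 / (250 * φ ^ 2) + 1 / (40 * φ)) = 1 / (250 * φ) + 1 / 40 := by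
      field_simp
    rw [this]
    gcongr
    linarith
  have h3 : (n : ℝ) * ((1 / 2) ^ φ / 10 ^ 10) ≤ 1 / 10 ^ 10 := by
    rw [one_div_pow, ← mul_div_assoc, mul_one_div]
    gcongr
    rw [div_le_one (by positivity)]
    exact hn
  linarith

theorem recursiveSumValue_prob_le (hg : IsHadamardFunction g) (A : Matrix (Fin n) (Fin n) ℝ)
    {F : HashFamily n Bool} {q : (Fin n → Bool) → PMF (Finset (Fin n × ℝ))} {a : ℝ≥0∞}
    (hF : F.PairwiseIndependent) (hε : 0 < ε) (hφ : 0 < φ) (hn : (n : ℝ) ≤ 2 ^ φ)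
    (hq : ∀ P, ((q P).prob fun Q =>
      ¬ HeavyRowsCorrect (rowWeight g A) (1 / 100 * ε) (heavyParam (1 / 100 * ε) φ) P Q) ≤ a) :
    (((levelsLaw F q φ).bind fun x => PMF.pure (recursiveSumValue g A φ x.1 x.2)).prob
      fun y => ¬ IsRelApprox ε y (hadamardNorm g A)) ≤ ENNReal.ofReal (1 / 10) + φ * a := by
  classical
  have hu := rowWeight_nonneg hg A
  rw [levelsLaw_eq_interleavedLaw]
  change ((interleavedLaw F q φ fun _ => true).map
    fun x => recursiveSumValue g A φ x.1 x.2).prob _ ≤ _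
  rw [PMF.prob_map]
  -- The potential measures weights relative to the total, so total weight zero is treated apart;
  -- there the output must be exactly 0.
  rcases (Finset.sum_nonneg fun i (_ : i ∈ Finset.univ) => hu i).eq_or_lt with h0 | hX
  · have hu0 : ∀ i, rowWeight g A i = 0 := fun i =>
      (Finset.sum_eq_zero_iff_of_nonneg fun i _ => hu i).1 h0.symm i (Finset.mem_univ i)
    have hA : hadamardNorm g A = 0 := h0.symm
    refine le_trans (PMF.prob_mono _ fun x hx => ?_)
      ((interleavedLaw_prob_zero_le hu0 hq φ _).trans le_add_self)
    intro hx0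
    refine hx ?_
    rw [recursiveSumValue_eq hg, hA]
    simp [hu0, sampledSum, hx0, IsRelApprox]
  · have hA : hadamardNorm g A = ∑ i, rowWeight g A i := rfl
    refine (PMF.prob_mono _ fun x hx => levelsFail_of_not_isRelApprox hg A x hx).trans ?_
    rw [hA]
    refine (interleavedLaw_prob_le hF hu hX hε hφ hq φ _ 0 1 one_pos).trans ?_
    gcongr
    simpa using sum_levelPotential_le hX hφ hn

end Failure

/-! ### The parameters -/

section Parameters

variable {n : ℕ}

theorem half_le_log (hn : 2 ≤ n) : 1 / 2 ≤ Real.log n := by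
  have h1 := Real.log_two_gt_d9
  have h2 : Real.log 2 ≤ Real.log n := Real.log_le_log (by norm_num) (by exact_mod_cast hn)
  linarith

theorem logSize_le {c : ℝ} (hc : 0 ≤ c) (hn : 2 ≤ n) :
    (logSize c n : ℝ) ≤ (c + 2) * Real.log n := by
  have h1 := half_le_log hn
  have h2 := (Nat.ceil_lt_add_one (mul_nonneg hc (by linarith : 0 ≤ Real.log n))).le
  unfold logSize
  linarith

theorem le_logSize (c : ℝ) (n : ℕ) : c * Real.log n ≤ logSize c n := Nat.le_ceil _

theorem logSize_pos {c : ℝ} (hc : 0 < c) (hn : 2 ≤ n) : 0 < logSize c n :=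
  Nat.ceil_pos.2 (mul_pos hc (by linarith [half_le_log hn]))

theorem le_two_pow_logSize (hn : 2 ≤ n) : (n : ℝ) ≤ 2 ^ logSize 2 n := by
  have h0 : (0 : ℝ) < n := by positivity
  have h1 := half_le_log hn
  have h2 := le_logSize 2 n
  have h3 := Real.log_two_gt_d9
  rw [← Real.log_le_log_iff h0 (by positivity), Real.log_pow]
  nlinarith

variable {ε r : ℝ}

theorem bucketCount_bounds (hn : 2 ≤ n) (hε : 0 < ε) (hε1 : ε ≤ 1) (hr : 1 ≤ r) :
    let φ := logSize 2 n
    let η := 1 / 100 * ε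
    let τ := bucketCount 20000 (rhoParam r η) (heavyParam η φ) n
    20000 * (r ^ 4 / η) * Real.log n / heavyParam η φ ^ 2 ≤ τ ∧
      (τ : ℝ) ≤ 10 ^ 19 * (1 / ε ^ 5 * r ^ 4 * Real.log n ^ 7) := by
  intro φ η τ
  have hl := half_le_log hn
  have hl0 : 0 < Real.log n := by linarith
  have hη : 0 < η := by positivity
  have hη1 : η ≤ 1 := by simp only [η]; linarith
  have hφ : 0 < φ := logSize_pos two_pos hn
  have hφ1 : (1 : ℝ) ≤ φ := by exact_mod_cast hφ
  have hφ4 : (φ : ℝ) ≤ 4 * Real.log n := (logSize_le (by norm_num) hn).trans_eq (by ring)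
  set x := 20000 * (r ^ 4 / η) * Real.log n / heavyParam η φ ^ 2 with hx
  have hxeq : x = 20000 * r ^ 4 * Real.log n * (φ : ℝ) ^ 6 / η ^ 5 := by
    rw [hx, heavyParam]
    field_simp
  have hτ : τ = 2 ^ Nat.clog 2 ⌈x⌉₊ := rfl
  have hx1 : 1 ≤ x := by
    rw [hxeq, one_le_div (by positivity)]
    calc η ^ 5 ≤ 1 := pow_le_one₀ hη.le hη1
      _ ≤ 20000 * 1 * (1 / 2) * 1 := by norm_num
      _ ≤ 20000 * r ^ 4 * Real.log n * (φ : ℝ) ^ 6 := by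
        gcongr
        · exact one_le_pow₀ hr
        · exact one_le_pow₀ hφ1
  constructor
  · refine (Nat.le_ceil x).trans ?_
    rw [hτ]
    exact_mod_cast Nat.le_pow_clog one_lt_two _
  -- Rounding up to a power of two at most doubles, and so does the ceiling because `1 ≤ x`; hence
  -- the factor 4 below.
  · have h1 : τ ≤ 2 * ⌈x⌉₊ := by
      rw [hτ]
      rcases Nat.lt_or_ge 1 ⌈x⌉₊ with h | h
      · have h2 := Nat.pow_pred_clog_lt_self one_lt_two h
        have h3 : Nat.clog 2 ⌈x⌉₊ = (Nat.clog 2 ⌈x⌉₊).pred + 1 :=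
          (Nat.succ_pred_eq_of_pos (Nat.clog_pos one_lt_two h)).symm
        rw [h3, pow_succ]
        omega
      · have h2 : 0 < ⌈x⌉₊ := Nat.ceil_pos.2 (by linarith)
        have h3 : ⌈x⌉₊ = 1 := by omega
        simp [h3]
    have h2 : (τ : ℝ) ≤ 2 * (⌈x⌉₊ : ℝ) := by exact_mod_cast h1
    have h3 := (Nat.ceil_lt_add_one (by linarith : 0 ≤ x)).le
    have h4 : (τ : ℝ) ≤ 4 * x := by linarith
    refine h4.trans ?_
    rw [hxeq]
    calc 4 * (20000 * r ^ 4 * Real.log n * (φ : ℝ) ^ 6 / η ^ 5)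
        ≤ 4 * (20000 * r ^ 4 * Real.log n * (4 * Real.log n) ^ 6 / η ^ 5) := by gcongr
      _ = 3276800000000000000 * (1 / ε ^ 5 * r ^ 4 * Real.log n ^ 7) := by
        simp only [η]
        field_simp
        norm_num
      _ ≤ 10 ^ 19 * (1 / ε ^ 5 * r ^ 4 * Real.log n ^ 7) := by
        gcongr
        norm_num

theorem pow_logSize_le (k : ℕ) (hn : 2 ≤ n) :
    ((24 : ℝ) / 25) ^ logSize (25 * k) n ≤ 1 / (n : ℝ) ^ k := by
  have h0 : (0 : ℝ) < n := by positivity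
  have h1 : (24 : ℝ) / 25 ≤ Real.exp (-(1 / 25)) := by
    have := Real.add_one_le_exp (-(1 / 25 : ℝ))
    linarith
  have h2 := le_logSize (25 * k) n
  calc ((24 : ℝ) / 25) ^ logSize (25 * k) n
      ≤ Real.exp (-(1 / 25)) ^ logSize (25 * k) n := by gcongr
    _ = Real.exp (logSize (25 * k) n * (-(1 / 25))) := by rw [← Real.exp_nat_mul]
    _ ≤ Real.exp (-(k * Real.log n)) := by
      apply Real.exp_le_exp.2
      linarith
    _ = 1 / (n : ℝ) ^ k := by
      rw [Real.exp_neg, mul_comm, Real.exp_mul, Real.exp_log h0, Real.rpow_natCast, one_div]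

theorem votes_failure_le {c : ℕ} (hn : 2 ≤ n) (hε : 0 < ε) (hr : 1 ≤ r)
    (hrc : r ≤ (n : ℝ) ^ c) (hεc : 1 / ε ≤ (n : ℝ) ^ c) {τ φ : ℝ}
    (hφ : φ ≤ 4 * Real.log n) (hτ0 : 0 ≤ τ)
    (hτ : τ ≤ 10 ^ 19 * (1 / ε ^ 5 * r ^ 4 * Real.log n ^ 7)) :
    φ * (τ * (2 * n * (24 / 25) ^ logSize (25 * ((9 * c + 100 : ℕ) : ℝ)) n)) ≤ 1 / 100 := by
  have hn2 : (2 : ℝ) ≤ n := by exact_mod_cast hn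
  have h0 : (0 : ℝ) < n := by linarith
  have hl := half_le_log hn
  have hln : Real.log n ≤ n := (Real.log_le_sub_one_of_pos h0).trans (by linarith)
  have h1 : τ ≤ 10 ^ 19 * (((n : ℝ) ^ c) ^ 5 * ((n : ℝ) ^ c) ^ 4 * (n : ℝ) ^ 7) := by
    refine hτ.trans ?_
    rw [← one_div_pow]
    gcongr
  have hq := pow_logSize_le (9 * c + 100) hn
  set w := ((24 : ℝ) / 25) ^ logSize (25 * ((9 * c + 100 : ℕ) : ℝ)) n with hw
  have hw0 : 0 ≤ w := by positivity
  have hφn : φ ≤ 4 * n := by linarith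
  -- The exponent `9 * c` absorbs `1 / ε ^ 5` and `r ^ 4`. Nine further powers of `n` absorb the
  -- logarithms and the union bound over rows, and the remaining 91 beat the constant.
  calc φ * (τ * (2 * n * w))
      ≤ (4 * n) * ((10 ^ 19 * (((n : ℝ) ^ c) ^ 5 * ((n : ℝ) ^ c) ^ 4 * (n : ℝ) ^ 7))
          * (2 * n * (1 / (n : ℝ) ^ (9 * c + 100)))) := by
        gcongr
    _ = 8 * 10 ^ 19 / (n : ℝ) ^ 91 := by
        have : (n : ℝ) ^ (9 * c + 100) = ((n : ℝ) ^ c) ^ 9 * (n : ℝ) ^ 9 * (n : ℝ) ^ 91 := by ring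
        rw [this]
        field_simp
        norm_num
    _ ≤ 8 * 10 ^ 19 / 2 ^ 91 := by gcongr
    _ ≤ 1 / 100 := by norm_num

end Parameters

/-! ### Total failure probability and total memory. -/

theorem total_failure_le {φ τ l x w d : ℝ} (hφ : φ ≤ 4 * l) (hl : 0 < l)
    (hτ : 0 < τ) (hx0 : 0 ≤ x) (hx : x / τ ≤ 1 / (400 * l)) (hw : φ * (τ * w) ≤ 1 / 100)
    (hd : d = 1 / (400 * τ * l)) :
    φ * (x / τ + τ * (w + d)) ≤ 3 / 100 := by
  have h1 : φ * (x / τ) ≤ 1 / 100 := by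
    calc φ * (x / τ) ≤ (4 * l) * (1 / (400 * l)) := by gcongr
      _ = 1 / 100 := by field_simp; norm_num
  have h2 : φ * (τ * d) ≤ 1 / 100 := by
    calc φ * (τ * d) = φ * (1 / (400 * l)) := by rw [hd]; field_simp
      _ ≤ (4 * l) * (1 / (400 * l)) := by gcongr
      _ = 1 / 100 := by field_simp; norm_num
  linarith

theorem total_space_le {φ N τ Fb Gb s1 s2 K l W cN : ℝ} (hl : 1 / 2 ≤ l) (hW : 1 ≤ W)
    (hφ : φ ≤ 4 * l) (hN0 : 0 ≤ N) (hN : N ≤ (cN + 2) * l) (hcN : 0 ≤ cN)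
    (hτ1 : 1 ≤ τ) (hτ : τ ≤ 10 ^ 19 * (W * l ^ 7)) (hFb0 : 0 ≤ Fb) (hFb : Fb ≤ K * l)
    (hGb0 : 0 ≤ Gb) (hGb : Gb ≤ K * (l + Real.log τ)) (hs1 : 0 ≤ s1) (hs2 : 0 ≤ s2) :
    φ * Fb + φ * (Gb + τ * (N * (Fb + 2 * s2) + s1)) ≤
      (10 ^ 21 * (|K| + 1) * (cN + 2)) *
        (W * l ^ 10 + W * l ^ 8 * s1 + W * l ^ 9 * s2) := by
  have hl0 : 0 < l := by linarith
  have hK := abs_nonneg K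
  have hKK := le_abs_self K
  have hlog : Real.log τ ≤ τ := (Real.log_le_sub_one_of_pos (by linarith)).trans (by linarith)
  have hlog0 : 0 ≤ Real.log τ := Real.log_nonneg hτ1
  have hFb' : Fb ≤ |K| * l := hFb.trans (by gcongr)
  have hGb' : Gb ≤ |K| * (l + τ) := hGb.trans (by gcongr)
  -- Pads lower powers of `l` up to the tenth; the logarithm may be as small as 1/2 in the
  -- hypotheses.
  have p : ∀ k : ℕ, 1 ≤ 2 ^ k * l ^ k := fun k => by
    rw [← mul_pow]
    exact one_le_pow₀ (by linarith)
  have t1 : φ * Fb ≤ 4 * 2 ^ 8 * |K| * (W * l ^ 10) := by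
    calc φ * Fb ≤ (4 * l) * (|K| * l) := by gcongr
      _ = 4 * |K| * l ^ 2 * 1 * 1 := by ring
      _ ≤ 4 * |K| * l ^ 2 * (2 ^ 8 * l ^ 8) * W := by
        gcongr
        exact p 8
      _ = _ := by ring
  have t2 : φ * Gb ≤ (4 * 2 ^ 8 + 16 * 10 ^ 19) * |K| * (W * l ^ 10) := by
    calc φ * Gb ≤ (4 * l) * (|K| * (l + 10 ^ 19 * (W * l ^ 7))) := by
          gcongr
          exact hGb'.trans (by gcongr)
      _ = 4 * |K| * l ^ 2 * 1 * 1 + 4 * 10 ^ 19 * |K| * W * l ^ 8 * 1 := by ring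
      _ ≤ 4 * |K| * l ^ 2 * (2 ^ 8 * l ^ 8) * W
          + 4 * 10 ^ 19 * |K| * W * l ^ 8 * (2 ^ 2 * l ^ 2) := by
        gcongr
        · exact p 8
        · exact p 2
      _ = _ := by ring
  have tφτ : φ * τ ≤ 4 * 10 ^ 19 * W * l ^ 8 := by
    calc φ * τ ≤ (4 * l) * (10 ^ 19 * (W * l ^ 7)) := by gcongr
      _ = _ := by ring
  have t3 : φ * τ * (N * Fb) ≤ 4 * 10 ^ 19 * (cN + 2) * |K| * (W * l ^ 10) := by
    calc φ * τ * (N * Fb) ≤ (4 * 10 ^ 19 * W * l ^ 8) * (((cN + 2) * l) * (|K| * l)) := by gcongr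
      _ = _ := by ring
  have t4 : φ * τ * (N * (2 * s2)) ≤ 8 * 10 ^ 19 * (cN + 2) * (W * l ^ 9 * s2) := by
    calc φ * τ * (N * (2 * s2)) ≤ (4 * 10 ^ 19 * W * l ^ 8) * (((cN + 2) * l) * (2 * s2)) := by
          gcongr
      _ = _ := by ring
  have t5 : φ * τ * s1 ≤ 4 * 10 ^ 19 * (W * l ^ 8 * s1) := by
    calc φ * τ * s1 ≤ (4 * 10 ^ 19 * W * l ^ 8) * s1 := by gcongr
      _ = _ := by ring
  have a1 : 0 ≤ W * l ^ 10 := by positivity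
  have a2 : 0 ≤ W * l ^ 9 * s2 := by positivity
  have a3 : 0 ≤ W * l ^ 8 * s1 := by positivity
  have c1 : 4 * 2 ^ 8 * |K| + (4 * 2 ^ 8 + 16 * 10 ^ 19) * |K| + 4 * 10 ^ 19 * (cN + 2) * |K|
      ≤ 10 ^ 21 * (|K| + 1) * (cN + 2) := by
    have : 0 ≤ |K| * cN := by positivity
    linarith
  have c2 : 8 * 10 ^ 19 * (cN + 2) ≤ 10 ^ 21 * (|K| + 1) * (cN + 2) := by
    have : 0 ≤ |K| * cN := by positivity
    linarith
  have c3 : 4 * 10 ^ 19 ≤ 10 ^ 21 * (|K| + 1) * (cN + 2) := by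
    have : 0 ≤ |K| * cN := by positivity
    linarith
  have m1 := mul_le_mul_of_nonneg_right c1 a1
  have m2 := mul_le_mul_of_nonneg_right c2 a2
  have m3 := mul_le_mul_of_nonneg_right c3 a3
  linarith

/-! ### The main theorem. -/

theorem theorem5 :
    -- absolute constants
    ∃ cη cφ cτ cT c₁ δ₂ : ℝ, 0 < cη ∧ cη ≤ 1 ∧ 0 < cφ ∧ 0 < cτ ∧ 0 < cT ∧ 0 < c₁ ∧
      0 < δ₂ ∧ δ₂ < 1 ∧
    ∀ (c : ℕ) (K : ℝ), ∃ cN C : ℝ, 0 < cN ∧ 0 < C ∧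
    ∀ (n : ℕ) (ε r : ℝ), 2 ≤ n → 0 < ε → ε ≤ 1 → 1 ≤ r →
      r ≤ (n : ℝ) ^ c → 1 / ε ≤ (n : ℝ) ^ c →
    ∀ (g : ℝ → ℝ), IsHadamardFunction g →
    ∀ (A : Matrix (Fin n) (Fin n) ℝ)
      (BA1 : (δ ε' : ℝ) → BlackBox n) (BA2 : (δ : ℝ) → BlackBox n),
      (∀ δ ε' : ℝ, 0 < δ → δ < 1 → 0 < ε' → ε' < 1 →
        ApproximatesAggregate g A δ ε' (BA1 δ ε')) →
      (∀ δ : ℝ, 0 < δ → δ < 1 → ApproximatesNorm g A δ r (BA2 δ)) →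
    -- the parameters of the algorithm
    let η : ℝ := cη * ε
    let φ : ℕ := logSize cφ n
    let N : ℕ := logSize cN n
    let τ : ℕ := bucketCount cτ (rhoParam r η) (heavyParam η φ) n
    let threshold : ℝ := 2 * r ^ 2 / (cT * η)
    let δ₁ : ℝ := 1 / (c₁ * τ * Real.log n)
    ∀ (F : HashFamily n Bool) (G : HashFamily n (Fin τ)),
      F.PairwiseIndependent → (F.bits : ℝ) ≤ K * Real.log n →
      G.PairwiseIndependent → (G.bits : ℝ) ≤ K * (Real.log n + Real.log τ) →
    let law : PMF (ℝ × ℕ) :=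
      (recursiveSum g F G (BA1 δ₁ (η / 2)) (BA2 δ₂) threshold N φ A).law
    law.toOuterMeasure {x | ¬ IsRelApprox ε x.1 (hadamardNorm g A)} ≤ 3 / 10 ∧
    ∀ x ∈ law.support,
      (x.2 : ℝ) ≤ C *
        (1 / ε ^ 5 * r ^ 4 * Real.log n ^ 10
          + 1 / ε ^ 5 * r ^ 4 * Real.log n ^ 8 * (BA1 δ₁ (η / 2)).space
          + 1 / ε ^ 5 * r ^ 4 * Real.log n ^ 9 * (BA2 δ₂).space) := by
  -- The value 1/25 turns the threshold into `50 * r ^ 2 / η`. Since 20000 = 50 · 400, the buckets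
  -- fail to isolate at one level with probability at most `1 / (400 * log n)`; with `φ ≤ 4 * log n`
  -- levels this costs 1/100, and so do the calls of `BA1`.
  refine ⟨1 / 100, 2, 20000, 1 / 25, 400, 1 / 100, by norm_num, by norm_num, by norm_num,
    by norm_num, by norm_num, by norm_num, by norm_num, by norm_num, fun c K => ?_⟩
  refine ⟨25 * ((9 * c + 100 : ℕ) : ℝ),
    10 ^ 21 * (|K| + 1) * (25 * ((9 * c + 100 : ℕ) : ℝ) + 2), by positivity, by positivity, ?_⟩
  intro n ε r hn hε hε1 hr hrc hεc g hg A BA1 BA2 hBA1 hBA2 η φ N τ threshold δ₁ F G hF hFb hG hGb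
    law
  have hl := half_le_log hn
  have hl0 : 0 < Real.log n := by linarith
  have hη : 0 < η := by positivity
  have hη1 : η ≤ 1 := by simp only [η]; linarith
  have hφ : 0 < φ := logSize_pos two_pos hn
  have hφ0 : (0 : ℝ) ≤ φ := Nat.cast_nonneg _
  have hφ4 : (φ : ℝ) ≤ 4 * Real.log n := (logSize_le (by norm_num) hn).trans_eq (by ring)
  have hN : 0 < N := logSize_pos (by positivity) hn
  have hα : 0 < heavyParam η φ := by unfold heavyParam; positivity
  obtain ⟨hτle, hτge⟩ := bucketCount_bounds (r := r) hn hε hε1 hr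
  have hτ1 : (1 : ℝ) ≤ τ := by exact_mod_cast (Nat.one_le_two_pow : 1 ≤ τ)
  have hτ0 : (0 : ℝ) < τ := by linarith
  have hT : threshold = 50 * r ^ 2 / η := by
    simp only [threshold]
    field_simp
    norm_num
  have hδ0 : 0 < δ₁ := by positivity
  have hδ1 : δ₁ < 1 := by
    simp only [δ₁]
    rw [div_lt_one (by positivity)]
    nlinarith
  constructor
  · have hout := recursiveSum_hasOutput F G (BA1 δ₁ (η / 2)) (BA2 (1 / 100)) threshold N φ A g
    refine (hout.law fun y => ¬ IsRelApprox ε y (hadamardNorm g A)).trans_le ?_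
    have hq : ∀ P, ((heavyRowsLaw F G ((BA1 δ₁ (η / 2)).run A) ((BA2 (1 / 100)).run A)
          threshold N P).prob fun Q => ¬ HeavyRowsCorrect (rowWeight g A) η (heavyParam η φ) P Q)
        ≤ ENNReal.ofReal (50 * (r ^ 4 / η) / (τ * heavyParam η φ ^ 2))
          + τ * (ENNReal.ofReal (2 * n * (24 / 25) ^ N) + ENNReal.ofReal δ₁) := by
      intro P
      rw [hT]
      refine heavyRowsLaw_prob_le hF hG (rowWeight_nonneg hg A) hr hη hη1 hα
        (fun H i => hg.abs_aggregate_sub_le H A i)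
        (hBA1 δ₁ (η / 2) hδ0 hδ1 (by positivity) (by linarith)) (fun H => ?_) hN P
      rw [← hadamardNorm_samplingIdentity hg]
      exact hBA2 (1 / 100) (by norm_num) (by norm_num) H
    refine (recursiveSumValue_prob_le hg A hF hε hφ (le_two_pow_logSize hn) hq).trans ?_
    have hx : 50 * (r ^ 4 / η) / (τ * heavyParam η φ ^ 2)
        = 50 * (r ^ 4 / η) / heavyParam η φ ^ 2 / τ := by
      rw [div_div, mul_comm (heavyParam η φ ^ 2)]
    have hx' : 50 * (r ^ 4 / η) / heavyParam η φ ^ 2 / τ ≤ 1 / (400 * Real.log n) := by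
      rw [div_le_div_iff₀ hτ0 (by positivity), one_mul]
      refine le_trans (le_of_eq ?_) hτle
      ring
    have htotal := total_failure_le hφ4 hl0 hτ0 (by positivity) hx'
      (votes_failure_le hn hε hr hrc hεc hφ4 hτ0.le hτge) (rfl : δ₁ = 1 / (400 * τ * Real.log n))
    rw [hx, ← ENNReal.ofReal_natCast τ, ← ENNReal.ofReal_natCast φ,
      ← ENNReal.ofReal_add (by positivity) hδ0.le, ← ENNReal.ofReal_mul hτ0.le,
      ← ENNReal.ofReal_add (by positivity) (by positivity), ← ENNReal.ofReal_mul hφ0,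
      ← ENNReal.ofReal_add (by norm_num) (by positivity)]
    -- The sum is 1/10 from the potential and 3/100 from incorrect heavy-row sets.
    refine (ENNReal.ofReal_le_ofReal (q := 3 / 10) (by linarith)).trans ?_
    rw [ENNReal.ofReal_div_of_pos (by norm_num)]
    simp
  · intro x hx
    have hspace := recursiveSum_usesAtMost F G (BA1 δ₁ (η / 2)) (BA2 (1 / 100)) threshold N φ A g
      0 x hx
    rw [zero_add] at hspace
    have hspace' : (x.2 : ℝ) ≤ φ * F.bits + φ * (G.bits + τ * (N * (F.bits
        + 2 * (BA2 (1 / 100)).space) + (BA1 δ₁ (η / 2)).space)) := by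
      exact_mod_cast hspace
    refine hspace'.trans (total_space_le hl ?_ hφ4 (Nat.cast_nonneg _)
      (logSize_le (by positivity) hn) (by positivity) hτ1 hτge (Nat.cast_nonneg _) hFb
      (Nat.cast_nonneg _) hGb (Nat.cast_nonneg _) (Nat.cast_nonneg _))
    rw [← one_div_pow]
    exact one_le_mul_of_one_le_of_one_le (one_le_pow₀ ((one_le_div hε).2 hε1)) (one_le_pow₀ hr)
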